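/- Let $X$ be a Tychonoff ($T_1$, completely regular) space and let a group $G$ act on $X$ so that every map $x\mapsto gx$ is continuous. Let $\mathcal D$ be either the family of all closed subsets of $X$ or the family of all zero sets $f^{-1}(0)$, $f\in C_b(X,\mathbb R)$. Let $wX$ be the Wallman extension of $X$ with respect to $\mathcal D$: its points are the maximal proper filters in $\mathcal D$, the sets $\bar F=\{Y: F\in Y\}$, $F\in\mathcal D$, form a base of its closed sets, $X$ is embedded by $x\mapsto\{F\in\mathcal D: x\in F\}$, and $G$ acts by $gY=\{gF: F\in Y\}$. (For all closed sets this is the usual Wallman extension; for zero sets it is $\beta X$.) A measure on $X$ (on $wX$) is a bounded finitely additive complex function on the algebra generated by $\mathcal D$ (by all closed subsets of $wX$) that is inner regular with respect to that family: for each $A$ in the algebra and $\varepsilon>0$ there is a member $F\subset A$ of the family such that $|m(B)|<\varepsilon$ for all $B\subset A\setminus F$ in the algebra. $|m|$ denotes the variation, $m^g(A)=m(g^{-1}A)$, and $|m|\ll|n|$ means that for each $\varepsilon>0$ there is $\delta>0$ such that $|n|(A)<\delta$ implies $|m|(A)<\varepsilon$. $Q(X,\mathbb C)$ and $Q(wX,\mathbb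 C)$ are the sets of quasi-invariant measures, i.e. those with $|m^g|\ll|m|\ll|m^g|$ for all $g\in G$. A filter in $\mathcal D$ is vanishing if its members have empty intersection; $m$ is real if $\lim m(F)=0$ along each vanishing filter in $\mathcal D$; $m$ is $\sigma$-smooth if it is countably additive on its algebra. A quasi-invariance factor $d_m(g,\cdot)$ is a Radon–Nikodym derivative of $m^g$ with respect to $m$ on the generated $\sigma$-algebra. Then there is a map $v:Q(X,\mathbb C)\to Q(wX,\mathbb C)$ such that for each $m\in Q(X,\mathbb C)$ and $p=v(m)$: (1) for each closed $F'\subset wX$ there are filters $\{F\}$ in $\mathcal D$ with $\bigcap\mathrm{cl}_{wX}F=F'$, and for every such filter $p(F')=\lim_{\{F\}}m(F)$; in particular $p(\mathrm{cl}_{wX}F)=m(F)$ for each $F\in\mathcal D$; (2) $m$ is real if and only if $p(F')=0$ for all closed $F'\subset wX$ with $F'\subset wX\setminus X$; (3) if $m$ and $p$ are $\sigma$-smooth and $|m|(X)<\infty$, then quasi-invariance factors $d_m$ and $d_p$ exist, and for each choice of $d_m$ the factor $d_p: G\times wX\to\mathbb C$ can be chosen so that $d_p(g,x)=d_m(g,x)$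 for each $g\in G$ and $m$-almost every $x\in X$. -/

import Mathlib

open Set Filter Topology MeasureTheory
open scoped ENNReal BoundedContinuousFunction

namespace QuasiInv

universe u v

/-- The two families of sets that may play the role of "closed sets" of `X`: all closed sets, or
the zero sets `f⁻¹(0)` of bounded continuous real functions. -/
inductive ClosedKind
  | all
  | zero

/-- The family of all closed sets, respectively of all zero sets, of `X`. -/
def closedFamily (X : Type u) [TopologicalSpace X] : ClosedKind → Set (Set X)
  | .all => {F | IsClosed F}
  | .zero => {F | ∃ f : X →ᵇ ℝ, F = f ⁻¹' {0}}

/-! ### Filters in a family of sets, and the Wallman extension -/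

section Filters

variable {X : Type u}

/-- A filter in the family `L` of subsets of `X` (the improper filter, which contains `∅`, is
allowed). -/
structure FilterIn (L : Set (Set X)) where
  sets : Set (Set X)
  subset_family : sets ⊆ L
  univ_mem : univ ∈ sets
  inter_mem : ∀ ⦃E F : Set X⦄, E ∈ sets → F ∈ sets → E ∩ F ∈ sets
  mem_of_superset : ∀ ⦃E F : Set X⦄, E ∈ sets → F ∈ L → E ⊆ F → F ∈ sets

/-- A filter is vanishing if the intersection of its members is empty. -/
def FilterIn.Vanishing {L : Set (Set X)} (S : FilterIn L) : Prop :=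
  ⋂₀ S.sets = ∅

/-- `m(F) → c` along the members `F` of the filter `S`, directed by reverse inclusion. -/
def FilterIn.Limit {L : Set (Set X)} (S : FilterIn L) (m : Set X → ℂ) (c : ℂ) : Prop :=
  Tendsto (fun F : S.sets => m (F : Set X)) atBot (𝓝 c)

/-- A point of the Wallman extension with respect to `L`: a maximal proper filter in `L`. -/
@[ext]
structure Wallman (L : Set (Set X)) extends FilterIn L where
  empty_notMem : ∅ ∉ sets
  maximal : ∀ T : FilterIn L, ∅ ∉ T.sets → sets ⊆ T.sets → T.sets ⊆ sets

/-- The basic closed subset of the Wallman extension given by `F`. -/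
def Wallman.basic (L : Set (Set X)) (F : Set X) : Set (Wallman L) := {Y | F ∈ Y.sets}

/-- The topology whose closed sets have the basic sets of the members of `L` as a base. -/
instance (L : Set (Set X)) : TopologicalSpace (Wallman L) :=
  TopologicalSpace.generateFrom {U | ∃ F ∈ L, U = (Wallman.basic L F)ᶜ}

/-- The family `L` contains the whole space and is preserved by the action of `G`. -/
class InvariantFamily (G : Type v) [Group G] [MulAction G X] (L : Set (Set X)) : Prop where
  univ_mem : univ ∈ L
  preimage_mem : ∀ (g : G) ⦃F : Set X⦄, F ∈ L → (fun x => g • x) ⁻¹' F ∈ L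

variable {G : Type v} [Group G] [MulAction G X] {L : Set (Set X)}

theorem preimage_smul_preimage (g h : G) (F : Set X) :
    (fun x : X => h • x) ⁻¹' ((fun x : X => g • x) ⁻¹' F) = (fun x : X => (g * h) • x) ⁻¹' F := by
  ext x
  simp [mul_smul]

/-- The translate `gS = {gF : F ∈ S}` of a filter, with `gF ∈ gS` written as `g⁻¹(gF) ∈ S`. -/
def FilterIn.translate [InvariantFamily G L] (g : G) (S : FilterIn L) : FilterIn L where
  sets := {F | F ∈ L ∧ (fun x => g • x) ⁻¹' F ∈ S.sets}
  subset_family := fun _ h => h.1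
  univ_mem := ⟨InvariantFamily.univ_mem G, by simpa using S.univ_mem⟩
  inter_mem := by
    intro E F hE hF
    have h : (fun x => g • x) ⁻¹' (E ∩ F) ∈ S.sets := S.inter_mem hE.2 hF.2
    refine ⟨?_, h⟩
    have h2 := InvariantFamily.preimage_mem (L := L) g⁻¹ (S.subset_family h)
    rw [preimage_smul_preimage] at h2
    simpa using h2
  mem_of_superset := by
    intro E F hE hF hEF
    exact ⟨hF, S.mem_of_superset hE.2 (InvariantFamily.preimage_mem g hF) (preimage_mono hEF)⟩

/-- The action of `G` on the Wallman extension, `gY = {gF : F ∈ Y}`. -/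
instance [InvariantFamily G L] : MulAction G (Wallman L) where
  smul g Y :=
    { Y.toFilterIn.translate g with
      empty_notMem := fun h => Y.empty_notMem (by simpa using h.2)
      maximal := by
        intro T hT hsub E hE
        refine ⟨T.subset_family hE, ?_⟩
        refine Y.maximal (T.translate g⁻¹) (fun h => hT (by simpa using h.2)) ?_ ?_
        · intro F hF
          refine ⟨Y.subset_family hF, hsub ⟨?_, ?_⟩⟩
          · exact InvariantFamily.preimage_mem g⁻¹ (Y.subset_family hF)
          · rw [preimage_smul_preimage]
            simpa using hF
        · refine ⟨InvariantFamily.preimage_mem g (T.subset_family hE), ?_⟩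
          rw [preimage_smul_preimage]
          simpa using hE }
  one_smul Y := by
    apply Wallman.ext
    ext F
    change (F ∈ L ∧ (fun x : X => (1 : G) • x) ⁻¹' F ∈ Y.sets) ↔ F ∈ Y.sets
    simpa using fun h => Y.subset_family h
  mul_smul g h Y := by
    apply Wallman.ext
    ext F
    change (F ∈ L ∧ (fun x : X => (g * h) • x) ⁻¹' F ∈ Y.sets) ↔
      (F ∈ L ∧ (fun x : X => g • x) ⁻¹' F ∈ L ∧
        (fun x : X => h • x) ⁻¹' ((fun x : X => g • x) ⁻¹' F) ∈ Y.sets)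
    rw [preimage_smul_preimage]
    exact ⟨fun H => ⟨H.1, InvariantFamily.preimage_mem g H.1, H.2⟩, fun H => ⟨H.1, H.2.2⟩⟩

end Filters

section Embedding

variable {X : Type u} [TopologicalSpace X]

theorem univ_mem_closedFamily (k : ClosedKind) : univ ∈ closedFamily X k := by
  cases k with
  | all => exact isClosed_univ
  | zero => exact ⟨0, by ext; simp⟩

theorem inter_mem_closedFamily (k : ClosedKind) {E F : Set X} (hE : E ∈ closedFamily X k)
    (hF : F ∈ closedFamily X k) : E ∩ F ∈ closedFamily X k := by
  cases k with
  | all => exact IsClosed.inter hE hF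
  | zero =>
    obtain ⟨f, rfl⟩ := hE
    obtain ⟨h, rfl⟩ := hF
    refine ⟨f * f + h * h, ?_⟩
    ext x
    simp [mul_self_add_mul_self_eq_zero]

instance {G : Type v} [Group G] [MulAction G X] [ContinuousConstSMul G X] (k : ClosedKind) :
    InvariantFamily G (closedFamily X k) where
  univ_mem := univ_mem_closedFamily k
  preimage_mem := by
    intro g F hF
    cases k with
    | all => exact IsClosed.preimage (continuous_const_smul g) hF
    | zero =>
      obtain ⟨f, rfl⟩ := hF
      exact ⟨f.compContinuous ⟨fun x => g • x, continuous_const_smul g⟩, rfl⟩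

theorem exists_disjoint_mem_closedFamily [T1Space X] (k : ClosedKind) {F : Set X}
    (hF : F ∈ closedFamily X k) {x : X} (hx : x ∉ F) :
    ∃ E ∈ closedFamily X k, x ∈ E ∧ E ∩ F = ∅ := by
  cases k with
  | all =>
    exact ⟨{x}, isClosed_singleton, rfl, by simpa using hx⟩
  | zero =>
    obtain ⟨f, rfl⟩ := hF
    refine ⟨(f - BoundedContinuousFunction.const X (f x)) ⁻¹' {0}, ⟨_, rfl⟩, by simp, ?_⟩
    ext y
    simp only [mem_inter_iff, mem_preimage, mem_singleton_iff, mem_empty_iff_false, iff_false,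
      not_and]
    intro h1 h2
    apply hx
    have h3 : f y - f x = 0 := h1
    have h4 : f x = 0 := by linarith
    exact h4

/-- The canonical embedding of `X` into its Wallman extension. -/
def toWallman [T1Space X] (k : ClosedKind) (x : X) : Wallman (closedFamily X k) where
  sets := {F | F ∈ closedFamily X k ∧ x ∈ F}
  subset_family := fun _ h => h.1
  univ_mem := ⟨univ_mem_closedFamily k, mem_univ x⟩
  inter_mem := fun _ _ hE hF => ⟨inter_mem_closedFamily k hE.1 hF.1, hE.2, hF.2⟩
  mem_of_superset := fun _ _ hE hF h => ⟨hF, h hE.2⟩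
  empty_notMem := fun h => h.2
  maximal := by
    intro T hT hsub F hF
    refine ⟨T.subset_family hF, ?_⟩
    by_contra hx
    obtain ⟨E, hE, hxE, hEF⟩ := exists_disjoint_mem_closedFamily k (T.subset_family hF) hx
    exact hT (hEF ▸ T.inter_mem (hsub ⟨hE, hxE⟩) hF)

end Embedding

/-! ### Measures -/

section Measures

variable {Y : Type u}

/-- A measure in the sense of finitely additive measure theory: a bounded, finitely additive,
`L`-regular complex function on the algebra generated by `L`. The value outside the algebra
is `0` by convention. -/
structure RegularMeasure (L : Set (Set Y)) where
  toFun : Set Y → ℂ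
  eq_zero_of_notMem : ∀ A, A ∉ generateSetAlgebra L → toFun A = 0
  additive : ∀ A ∈ generateSetAlgebra L, ∀ B ∈ generateSetAlgebra L, Disjoint A B →
    toFun (A ∪ B) = toFun A + toFun B
  bounded : ∃ C : ℝ, ∀ A ∈ generateSetAlgebra L, ‖toFun A‖ ≤ C
  regular : ∀ A ∈ generateSetAlgebra L, ∀ ε : ℝ, 0 < ε → ∃ F ∈ L, F ⊆ A ∧
    ∀ B ∈ generateSetAlgebra L, B ⊆ A \ F → ‖toFun B‖ < ε

instance (L : Set (Set Y)) : CoeFun (RegularMeasure L) (fun _ => Set Y → ℂ) :=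
  ⟨RegularMeasure.toFun⟩

/-- The variation `|m|(A)` of a set function on the algebra generated by `L`: the supremum of
`∑ |m(B)|` over finite disjoint families of members `B ⊆ A` of the algebra. -/
noncomputable def variation (L : Set (Set Y)) (m : Set Y → ℂ) (A : Set Y) : ℝ≥0∞ :=
  ⨆ (P : Finset (Set Y)) (_ : ∀ B ∈ P, B ∈ generateSetAlgebra L ∧ B ⊆ A)
    (_ : (P : Set (Set Y)).PairwiseDisjoint id), ∑ B ∈ P, ‖m B‖ₑ

/-- Absolute continuity `|m| ≪ |n|` of finitely additive measures: `|m|(A) → 0` as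
`|n|(A) → 0`. -/
def AbsCont (L : Set (Set Y)) (m n : Set Y → ℂ) : Prop :=
  ∀ ε : ℝ≥0∞, 0 < ε → ∃ δ : ℝ≥0∞, 0 < δ ∧ ∀ A ∈ generateSetAlgebra L,
    variation L n A < δ → variation L m A < ε

/-- The translated measure `m^g(A) = m(g⁻¹A)`. -/
def measureTranslate {G : Type v} [Group G] [MulAction G Y] (g : G) (m : Set Y → ℂ) : Set Y → ℂ :=
  fun A => m ((fun y => g • y) ⁻¹' A)

/-- `m` is quasi-invariant relative to `G`: each `m^g` is equivalent to `m`. -/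
def IsQuasiInvariant (G : Type v) [Group G] [MulAction G Y] {L : Set (Set Y)}
    (m : RegularMeasure L) : Prop :=
  ∀ g : G, AbsCont L (measureTranslate g m) m ∧ AbsCont L m (measureTranslate g m)

/-- The space of complex measures quasi-invariant relative to `G`. -/
def QuasiInvariantMeasure (G : Type v) [Group G] [MulAction G Y] (L : Set (Set Y)) : Type u :=
  {m : RegularMeasure L // IsQuasiInvariant G m}

/-- `m` is real: `m(F) → 0` along each vanishing filter in `L`. -/
def IsRealMeasure {L : Set (Set Y)} (m : RegularMeasure L) : Prop :=
  ∀ S : FilterIn L, S.Vanishing → S.Limit m 0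

/-- `m` is `σ`-smooth: it is countably additive on its algebra, in the form of continuity
at `∅`. -/
def IsSigmaSmooth {L : Set (Set Y)} (m : RegularMeasure L) : Prop :=
  ∀ A : ℕ → Set Y, (∀ n, A n ∈ generateSetAlgebra L) → Antitone A → ⋂ n, A n = ∅ →
    Tendsto (fun n => m (A n)) atTop (𝓝 0)

/-- `μ` is the extension of the variation `|m|` to a measure on the `σ`-algebra generated
by `L`. -/
def IsVariationMeasure {L : Set (Set Y)} (m : RegularMeasure L)
    (μ : @Measure Y (MeasurableSpace.generateFrom L)) : Prop :=
  ∀ A ∈ generateSetAlgebra L, μ A = variation L m A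

/-- `d` is a quasi-invariance factor of `m`, that is, `d(g, ·)` is a Radon-Nikodym derivative of
`m^g` with respect to `m`. The integral against `m` is taken through the polar decomposition
`m(dx) = f(x) |m|(dx)` with `|f| = 1`. -/
def IsQuasiInvarianceFactor {G : Type v} [Group G] [MulAction G Y] {L : Set (Set Y)}
    (m : RegularMeasure L) (d : G → Y → ℂ) : Prop :=
  ∃ (μ : @Measure Y (MeasurableSpace.generateFrom L)) (f : Y → ℂ),
    IsVariationMeasure m μ ∧
    Measurable[MeasurableSpace.generateFrom L] f ∧ (∀ y, ‖f y‖ = 1) ∧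
    (∀ A ∈ generateSetAlgebra L, m A = ∫ y in A, f y ∂μ) ∧
    ∀ g : G, Measurable[MeasurableSpace.generateFrom L] (d g) ∧ Integrable (d g) μ ∧
      ∀ A ∈ generateSetAlgebra L, measureTranslate g m A = ∫ y in A, d g y * f y ∂μ

end Measures

end QuasiInv

/-! The Wallman space is compact, and `X` sits in it so that the basic closed sets reproduce the
lattice `L`. A finitely additive regular content on `X` therefore becomes countably additive there:
any countable cover of a basic set by open sets reduces to a finite one, where finite additivity on
`X` suffices. This gives `exists_isWallmanExtension`: a nonnegative regular content `a` extends to a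
regular Borel measure with value `a F` on the basic set of `F`.

For complex `m`, the contents `|m|`, `|m| + Re m` and `|m| + Im m` are nonnegative and regular.
Their extensions `μ`, `α`, `β` yield `p = (α - μ) + i(β - μ)`, and regularity forces the variation
of `p` to be exactly `μ` (`IsWallmanExtension.norm_le`, `IsWallmanExtension.exists_isExtension`).

Everything else is transferred by approximation: a Borel set is approximated from inside by a closed
set, and a closed set from outside by a basic set, where `p` and `m` agree. In this way
`IsExtension.limit` gives the limit formula, from which the criterion for real measures follows, and
`IsExtension.isQuasiInvariant` carries quasi-invariance over.

In the `σ`-smooth case `|m|` extends to a measure, and `m` has a polar decomposition against it.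
Quasi-invariance makes the translated measure absolutely continuous, so Radon-Nikodym gives `d_m`.
The `σ`-algebra of `X` is pulled back from the one generated by the basic sets, so `d_m` factors
through the embedding. The factored function is `d_p`: the required integral identities hold on
basic sets, hence on the whole algebra by `IsWallmanExtension.eq_of_eq_basic`. -/

namespace QuasiInv

universe u v

/-! ### Variation of a finitely additive set function -/

section Variation

variable {Y : Type u} {L : Set (Set Y)} {m : Set Y → ℂ} {A B : Set Y}

/-- Finite additivity on the algebra generated by `L`. -/
def IsAdditiveOn (L : Set (Set Y)) (m : Set Y → ℂ) : Prop :=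
  ∀ A ∈ generateSetAlgebra L, ∀ B ∈ generateSetAlgebra L, Disjoint A B → m (A ∪ B) = m A + m B

theorem IsAdditiveOn.empty (hm : IsAdditiveOn L m) : m ∅ = 0 := by
  have h := hm ∅ .empty ∅ .empty (disjoint_empty ∅)
  simpa using h

theorem IsAdditiveOn.biUnion (hm : IsAdditiveOn L m) {ι : Type*} (s : Finset ι)
    {f : ι → Set Y} (hf : ∀ i ∈ s, f i ∈ generateSetAlgebra L)
    (hd : (s : Set ι).PairwiseDisjoint f) : m (⋃ i ∈ s, f i) = ∑ i ∈ s, m (f i) := by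
  classical
  induction s using Finset.induction_on with
  | empty => simpa using hm.empty
  | insert i s hi ih =>
    rw [Finset.set_biUnion_insert, Finset.sum_insert hi, hm, ih]
    · exact fun j hj => hf j (Finset.mem_insert_of_mem hj)
    · exact hd.subset (by simp)
    · exact hf i (Finset.mem_insert_self i s)
    · exact isSetAlgebra_generateSetAlgebra.biUnion_mem s
        fun j hj => hf j (Finset.mem_insert_of_mem hj)
    · simp only [disjoint_iUnion_right]
      intro j hj
      exact hd (by simp) (by simp [hj]) (by rintro rfl; exact hi hj)

theorem IsAdditiveOn.sdiff (hm : IsAdditiveOn L m) (hA : A ∈ generateSetAlgebra L)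
    (hB : B ∈ generateSetAlgebra L) (h : B ⊆ A) : m (A \ B) = m A - m B := by
  have := hm B hB (A \ B) (isSetAlgebra_generateSetAlgebra.sdiff_mem hA hB) disjoint_sdiff_right
  rw [union_sdiff_cancel h] at this
  rw [this]
  ring

theorem variation_le {c : ℝ≥0∞} (h : ∀ P : Finset (Set Y),
    (∀ B ∈ P, B ∈ generateSetAlgebra L ∧ B ⊆ A) → (P : Set (Set Y)).PairwiseDisjoint id →
      ∑ B ∈ P, ‖m B‖ₑ ≤ c) : variation L m A ≤ c :=
  iSup_le fun P => iSup_le fun h1 => iSup_le fun h2 => h P h1 h2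

theorem exists_lt_sum_of_lt_variation {c : ℝ≥0∞} (h : c < variation L m A) :
    ∃ P : Finset (Set Y), (∀ B ∈ P, B ∈ generateSetAlgebra L ∧ B ⊆ A) ∧
      (P : Set (Set Y)).PairwiseDisjoint id ∧ c < ∑ B ∈ P, ‖m B‖ₑ := by
  by_contra! H
  exact h.not_ge (variation_le H)

theorem variation_mono (h : A ⊆ B) : variation L m A ≤ variation L m B := by
  refine variation_le fun P h1 h2 => ?_
  exact le_iSup_of_le P (le_iSup_of_le (fun C hC => ⟨(h1 C hC).1, (h1 C hC).2.trans h⟩)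
    (le_iSup_of_le h2 le_rfl))

/-- The variation is defined through finite sets of sets, whereas the later arguments produce
indexed families. Only the empty set can be repeated in a disjoint family, and it contributes zero,
so discarding it makes the indexing injective. -/
theorem sum_le_variation (h0 : m ∅ = 0) {ι : Type*} (s : Finset ι) {f : ι → Set Y}
    (hf : ∀ i ∈ s, f i ∈ generateSetAlgebra L ∧ f i ⊆ A)
    (hd : (s : Set ι).PairwiseDisjoint f) : ∑ i ∈ s, ‖m (f i)‖ₑ ≤ variation L m A := by
  classical
  let t := s.filter fun i => f i ≠ ∅
  have h1 : ∑ i ∈ s, ‖m (f i)‖ₑ = ∑ i ∈ t, ‖m (f i)‖ₑ := by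
    symm
    apply Finset.sum_subset (Finset.filter_subset _ _)
    intro i hi hit
    have : f i = ∅ := by
      by_contra h
      exact hit (Finset.mem_filter.2 ⟨hi, h⟩)
    simp [this, h0]
  have hinj : Set.InjOn f t := by
    intro i hi j hj hij
    by_contra hne
    have hi' := Finset.mem_filter.1 hi
    have hj' := Finset.mem_filter.1 hj
    have := hd hi'.1 hj'.1 hne
    simp only [Function.onFun, ← hij, disjoint_self, bot_eq_empty] at this
    exact hi'.2 this
  rw [h1, ← Finset.sum_image (f := fun B => ‖m B‖ₑ) hinj]
  refine le_iSup_of_le (t.image f) (le_iSup_of_le ?_ (le_iSup_of_le ?_ le_rfl))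
  · intro B hB
    obtain ⟨i, hi, rfl⟩ := Finset.mem_image.1 hB
    exact hf i (Finset.mem_filter.1 hi).1
  · intro B hB C hC hBC
    obtain ⟨i, hi, rfl⟩ := Finset.mem_image.1 (Finset.mem_coe.1 hB)
    obtain ⟨j, hj, rfl⟩ := Finset.mem_image.1 (Finset.mem_coe.1 hC)
    exact hd (Finset.mem_filter.1 hi).1 (Finset.mem_filter.1 hj).1 (by rintro rfl; exact hBC rfl)

theorem enorm_le_variation (h0 : m ∅ = 0) (hB : B ∈ generateSetAlgebra L) (h : B ⊆ A) :
    ‖m B‖ₑ ≤ variation L m A := by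
  have := sum_le_variation (L := L) (A := A) h0 ({()} : Finset Unit) (f := fun _ => B)
    (fun _ _ => ⟨hB, h⟩) (by simp)
  simpa using this

theorem variation_empty (h0 : m ∅ = 0) : variation L m ∅ = 0 := by
  refine le_antisymm (variation_le fun P hP _ => ?_) (zero_le)
  refine (Finset.sum_eq_zero fun B hB => ?_).le
  rw [subset_empty_iff.1 (hP B hB).2, h0, enorm_zero]

theorem variation_union (hm : IsAdditiveOn L m) (hA : A ∈ generateSetAlgebra L)
    (hB : B ∈ generateSetAlgebra L) (hAB : Disjoint A B) :
    variation L m (A ∪ B) = variation L m A + variation L m B := by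
  apply le_antisymm
  · refine variation_le fun P hP hd => ?_
    have key : ∀ C ∈ P, ‖m C‖ₑ ≤ ‖m (C ∩ A)‖ₑ + ‖m (C ∩ B)‖ₑ := by
      intro C hC
      have hu : C = (C ∩ A) ∪ (C ∩ B) := by
        rw [← inter_union_distrib_left, inter_eq_left.2 (hP C hC).2]
      conv_lhs => rw [hu]
      rw [hm _ (isSetAlgebra_generateSetAlgebra.inter_mem (hP C hC).1 hA) _
        (isSetAlgebra_generateSetAlgebra.inter_mem (hP C hC).1 hB)
        (hAB.mono inter_subset_right inter_subset_right)]
      exact enorm_add_le _ _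
    refine (Finset.sum_le_sum key).trans ?_
    rw [Finset.sum_add_distrib]
    have aux : ∀ D ∈ generateSetAlgebra L, ∑ C ∈ P, ‖m (C ∩ D)‖ₑ ≤ variation L m D := by
      intro D hD
      refine sum_le_variation hm.empty P (f := fun C => C ∩ D) (fun C hC =>
        ⟨isSetAlgebra_generateSetAlgebra.inter_mem (hP C hC).1 hD, inter_subset_right⟩) ?_
      intro C hC C' hC' hne
      exact (hd hC hC' hne).mono inter_subset_left inter_subset_left
    exact add_le_add (aux A hA) (aux B hB)
  · have hsub : ∀ D : Set Y, variation L m D = ⨆ P : {P : Finset (Set Y) //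
        (∀ C ∈ P, C ∈ generateSetAlgebra L ∧ C ⊆ D) ∧ (P : Set (Set Y)).PairwiseDisjoint id},
        ∑ C ∈ P.1, ‖m C‖ₑ := by
      intro D
      simp only [variation, iSup_subtype, iSup_and]
    have hne : ∀ D : Set Y, Nonempty {P : Finset (Set Y) //
        (∀ C ∈ P, C ∈ generateSetAlgebra L ∧ C ⊆ D) ∧ (P : Set (Set Y)).PairwiseDisjoint id} :=
      fun D => ⟨⟨∅, by simp, by simp⟩⟩
    have := hne A
    have := hne B
    rw [hsub A, hsub B]
    -- A partition inside `A` and one inside `B` combine into one inside `A ∪ B`; indexing by the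
    -- sum type keeps empty members common to both from being merged.
    refine ENNReal.iSup_add_iSup_le fun P Q => ?_
    rw [← Finset.sum_coe_sort P.1, ← Finset.sum_coe_sort Q.1]
    have := sum_le_variation (L := L) (A := A ∪ B) hm.empty
      (Finset.univ : Finset (P.1 ⊕ Q.1)) (f := Sum.elim (fun C => C.1) (fun C => C.1)) ?_ ?_
    · simpa using this
    · rintro (C | C) -
      · exact ⟨(P.2.1 C.1 C.2).1, (P.2.1 C.1 C.2).2.trans subset_union_left⟩
      · exact ⟨(Q.2.1 C.1 C.2).1, (Q.2.1 C.1 C.2).2.trans subset_union_right⟩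
    · rintro (C | C) - (D | D) - hne
      · exact P.2.2 C.2 D.2 fun h => hne (congrArg _ (Subtype.ext h))
      · exact hAB.mono (P.2.1 C.1 C.2).2 (Q.2.1 D.1 D.2).2
      · exact (hAB.mono (P.2.1 D.1 D.2).2 (Q.2.1 C.1 C.2).2).symm
      · exact Q.2.2 C.2 D.2 fun h => hne (congrArg _ (Subtype.ext h))

theorem sum_abs_le_two_mul {ι : Type*} (s : Finset ι) (r : ι → ℝ) {c : ℝ}
    (h : ∀ t ⊆ s, |∑ i ∈ t, r i| ≤ c) : ∑ i ∈ s, |r i| ≤ 2 * c := by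
  classical
  rw [← Finset.sum_filter_add_sum_filter_not s (fun i => 0 ≤ r i)]
  have h1 := (le_abs_self _).trans (h (s.filter fun i => 0 ≤ r i) (Finset.filter_subset _ _))
  have h2 := (neg_le_abs _).trans (h (s.filter fun i => ¬ 0 ≤ r i) (Finset.filter_subset _ _))
  have e1 : ∑ i ∈ s.filter (fun i => 0 ≤ r i), |r i| = ∑ i ∈ s.filter (fun i => 0 ≤ r i), r i :=
    Finset.sum_congr rfl fun i hi => abs_of_nonneg (Finset.mem_filter.1 hi).2
  have e2 : ∑ i ∈ s.filter (fun i => ¬ 0 ≤ r i), |r i| =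
      -∑ i ∈ s.filter (fun i => ¬ 0 ≤ r i), r i := by
    rw [← Finset.sum_neg_distrib]
    exact Finset.sum_congr rfl fun i hi => abs_of_neg (not_le.1 (Finset.mem_filter.1 hi).2)
  rw [e1, e2]
  linarith

/-- Every subfamily of a partition has union in the algebra, so its partial sum is bounded by `c`.
Splitting by sign costs a factor 2, and splitting into real and imaginary parts another 2. This
turns boundedness and regularity of `m` into finiteness and regularity of `|m|`. -/
theorem variation_le_of_norm_le (hm : IsAdditiveOn L m) {c : ℝ}
    (h : ∀ B ∈ generateSetAlgebra L, B ⊆ A → ‖m B‖ ≤ c) :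
    variation L m A ≤ ENNReal.ofReal (4 * c) := by
  classical
  refine variation_le fun P hP hd => ?_
  have key : ∀ t ⊆ P, ‖∑ B ∈ t, m B‖ ≤ c := by
    intro t ht
    have hmem : ∀ B ∈ t, id B ∈ generateSetAlgebra L := fun B hB => (hP B (ht hB)).1
    have := hm.biUnion t (f := id) hmem (hd.subset (by exact_mod_cast ht))
    simp only [id] at this
    rw [← this]
    exact h _ (isSetAlgebra_generateSetAlgebra.biUnion_mem t hmem)
      (iUnion₂_subset fun B hB => (hP B (ht hB)).2)
  have hre := sum_abs_le_two_mul P (fun B => (m B).re) (c := c) fun t ht => by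
    rw [← Complex.re_sum]
    exact (Complex.abs_re_le_norm _).trans (key t ht)
  have him := sum_abs_le_two_mul P (fun B => (m B).im) (c := c) fun t ht => by
    rw [← Complex.im_sum]
    exact (Complex.abs_im_le_norm _).trans (key t ht)
  have hsum : ∑ B ∈ P, ‖m B‖ ≤ 4 * c := by
    calc ∑ B ∈ P, ‖m B‖ ≤ ∑ B ∈ P, (|(m B).re| + |(m B).im|) :=
          Finset.sum_le_sum fun B _ => Complex.norm_le_abs_re_add_abs_im _
      _ ≤ 4 * c := by
          rw [Finset.sum_add_distrib]
          linarith
  calc ∑ B ∈ P, ‖m B‖ₑ = ENNReal.ofReal (∑ B ∈ P, ‖m B‖) := by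
        rw [ENNReal.ofReal_sum_of_nonneg fun _ _ => norm_nonneg _]
        simp only [ofReal_norm]
    _ ≤ _ := ENNReal.ofReal_le_ofReal hsum

theorem variation_measureTranslate {G : Type v} [Group G] [MulAction G Y]
    (hG : ∀ (g : G), ∀ A ∈ generateSetAlgebra L, (fun y => g • y) ⁻¹' A ∈ generateSetAlgebra L)
    (h0 : m ∅ = 0) (g : G) (A : Set Y) :
    variation L (measureTranslate g m) A = variation L m ((fun y => g • y) ⁻¹' A) := by
  have hinv : ∀ (h : G) (B : Set Y),
      (fun y => h • y) ⁻¹' ((fun y => h⁻¹ • y) ⁻¹' B) = B := by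
    intro h B
    ext y
    simp
  apply le_antisymm
  · refine variation_le fun P hP hd => ?_
    exact sum_le_variation h0 P (f := fun B => (fun y => g • y) ⁻¹' B)
      (fun B hB => ⟨hG g B (hP B hB).1, preimage_mono (hP B hB).2⟩)
      fun B hB C hC hne => (hd hB hC hne).preimage _
  · refine variation_le fun P hP hd => ?_
    have := sum_le_variation (L := L) (m := measureTranslate g m) (A := A)
      (by simpa [measureTranslate] using h0) P (f := fun B => (fun y => g⁻¹ • y) ⁻¹' B)
      (fun B hB => ⟨hG g⁻¹ B (hP B hB).1, ?_⟩)
      fun B hB C hC hne => (hd hB hC hne).preimage _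
    · simpa only [measureTranslate, hinv] using this
    · intro y hy
      simpa using (hP B hB).2 hy

theorem preimage_mem_generateSetAlgebra {Z : Type*} {M : Set (Set Z)} {φ : Z → Y}
    (hφ : ∀ F ∈ L, φ ⁻¹' F ∈ generateSetAlgebra M) (hA : A ∈ generateSetAlgebra L) :
    φ ⁻¹' A ∈ generateSetAlgebra M := by
  induction hA with
  | base s hs => exact hφ s hs
  | empty => exact .empty
  | compl s _ ih => exact .compl _ ih
  | union s t _ _ ihs iht => exact .union _ _ ihs iht

end Variation

/-! ### Finiteness and regularity of the variation -/

section RegularMeasure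

variable {Y : Type u} {L : Set (Set Y)} (m : RegularMeasure L)

theorem RegularMeasure.isAdditiveOn : IsAdditiveOn L m := m.additive

theorem RegularMeasure.empty : m ∅ = 0 := m.isAdditiveOn.empty

theorem RegularMeasure.variation_ne_top (A : Set Y) : variation L m A ≠ ⊤ := by
  obtain ⟨C, hC⟩ := m.bounded
  exact ((variation_le_of_norm_le m.isAdditiveOn fun B hB _ => hC B hB).trans_lt
    ENNReal.ofReal_lt_top).ne

theorem RegularMeasure.variation_regular {A : Set Y} (hA : A ∈ generateSetAlgebra L) {ε : ℝ≥0∞}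
    (hε : 0 < ε) : ∃ F ∈ L, F ⊆ A ∧ variation L m (A \ F) < ε := by
  obtain ⟨δ, -, hδ, hδε⟩ := ENNReal.lt_iff_exists_real_btwn.1 hε
  rw [ENNReal.ofReal_pos] at hδ
  obtain ⟨F, hF, hFA, h⟩ := m.regular A hA (δ / 4) (by positivity)
  refine ⟨F, hF, hFA, lt_of_le_of_lt ?_ hδε⟩
  have := variation_le_of_norm_le m.isAdditiveOn fun B hB hBA => (h B hB hBA).le
  rwa [mul_div_cancel₀ δ four_ne_zero] at this

theorem RegularMeasure.norm_le_variation {A : Set Y} (hA : A ∈ generateSetAlgebra L) :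
    ‖m A‖ ≤ (variation L m A).toReal := by
  rw [← toReal_enorm]
  exact ENNReal.toReal_mono (m.variation_ne_top A) (enorm_le_variation m.empty hA Subset.rfl)

end RegularMeasure

/-! ### The Wallman space of a set lattice: basic sets, compactness, group action -/

section WallmanTopology

variable {X : Type u} {L : Set (Set X)}

/-- A lattice of subsets of `X` containing `∅` and the whole space. -/
structure IsSetLattice (L : Set (Set X)) : Prop where
  empty_mem : ∅ ∈ L
  univ_mem : univ ∈ L
  union_mem : ∀ ⦃E F : Set X⦄, E ∈ L → F ∈ L → E ∪ F ∈ L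
  inter_mem : ∀ ⦃E F : Set X⦄, E ∈ L → F ∈ L → E ∩ F ∈ L

theorem isSetLattice_closedFamily [TopologicalSpace X] (k : ClosedKind) :
    IsSetLattice (closedFamily X k) where
  empty_mem := by
    cases k with
    | all => exact isClosed_empty
    | zero => exact ⟨1, by ext; simp⟩
  univ_mem := univ_mem_closedFamily k
  union_mem := by
    intro E F hE hF
    cases k with
    | all => exact IsClosed.union hE hF
    | zero =>
      obtain ⟨f, rfl⟩ := hE
      obtain ⟨h, rfl⟩ := hF
      exact ⟨f * h, by ext; simp⟩
  inter_mem := fun _ _ => inter_mem_closedFamily k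

/-- The trace on `K` of a filter `S`, as a filter in `L`. -/
def FilterIn.trace (hL : IsSetLattice L) (S : FilterIn L) (K : Set X) : FilterIn L where
  sets := {F | F ∈ L ∧ ∃ E ∈ S.sets, E ∩ K ⊆ F}
  subset_family := fun _ h => h.1
  univ_mem := ⟨hL.univ_mem, univ, S.univ_mem, subset_univ _⟩
  inter_mem := by
    rintro E F ⟨hE, E', hE', hEE⟩ ⟨hF, F', hF', hFF⟩
    refine ⟨hL.inter_mem hE hF, E' ∩ F', S.inter_mem hE' hF', fun x hx => ⟨hEE ?_, hFF ?_⟩⟩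
    · exact ⟨hx.1.1, hx.2⟩
    · exact ⟨hx.1.2, hx.2⟩
  mem_of_superset := by
    rintro E F ⟨_, E', hE', hEE⟩ hF hEF
    exact ⟨hF, E', hE', hEE.trans hEF⟩

/-- Zorn's lemma, applied to the underlying collections of sets: the union of a chain of proper
filters is a proper filter. -/
theorem FilterIn.exists_wallman (S : FilterIn L) (hS : ∅ ∉ S.sets) :
    ∃ Y : Wallman L, S.sets ⊆ Y.sets := by
  obtain ⟨M, hSM, hM⟩ := zorn_subset_nonempty
    {s : Set (Set X) | ∃ T : FilterIn L, T.sets = s ∧ ∅ ∉ s} (by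
      intro c hc hchain hne
      have hne' : c.Nonempty := hne
      refine ⟨⋃₀ c, ⟨{ sets := ⋃₀ c, subset_family := ?_, univ_mem := ?_, inter_mem := ?_,
                       mem_of_superset := ?_ }, rfl, ?_⟩, fun s hs => subset_sUnion_of_mem hs⟩
      · rintro F ⟨s, hs, hF⟩
        obtain ⟨T, rfl, -⟩ := hc hs
        exact T.subset_family hF
      · obtain ⟨s, hs⟩ := hne'
        obtain ⟨T, hT, -⟩ := hc hs
        exact ⟨s, hs, hT ▸ T.univ_mem⟩
      · rintro E F ⟨s, hs, hE⟩ ⟨t, ht, hF⟩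
        rcases hchain.total hs ht with h | h
        · obtain ⟨T, rfl, -⟩ := hc ht
          exact ⟨_, ht, T.inter_mem (h hE) hF⟩
        · obtain ⟨T, rfl, -⟩ := hc hs
          exact ⟨_, hs, T.inter_mem hE (h hF)⟩
      · rintro E F ⟨s, hs, hE⟩ hF hEF
        obtain ⟨T, rfl, -⟩ := hc hs
        exact ⟨_, hs, T.mem_of_superset hE hF hEF⟩
      · rintro ⟨s, hs, h⟩
        obtain ⟨T, rfl, h'⟩ := hc hs
        exact h' h) S.sets ⟨S, rfl, hS⟩
  obtain ⟨⟨T, rfl, hT⟩, hmax⟩ := hM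
  exact ⟨{ T with
    empty_notMem := hT
    maximal := fun T' hT' h => hmax ⟨T', rfl, hT'⟩ h }, hSM⟩

/-- If every member of `Y` met `F`, the trace of `Y` on `F` would be a proper filter containing `Y`
and `F`, contrary to maximality. -/
theorem Wallman.exists_disjoint (hL : IsSetLattice L) (Y : Wallman L) {F : Set X} (hF : F ∈ L)
    (h : F ∉ Y.sets) : ∃ E ∈ Y.sets, E ∩ F = ∅ := by
  by_contra! H
  refine h (Y.maximal (Y.toFilterIn.trace hL F) ?_ ?_ ⟨hF, univ, Y.univ_mem, inter_subset_right⟩)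
  · rintro ⟨-, E, hE, hEF⟩
    exact (H E hE).ne_empty (subset_empty_iff.1 hEF)
  · exact fun E hE => ⟨Y.subset_family hE, E, hE, inter_subset_left⟩

theorem Wallman.basic_mono {E F : Set X} (hF : F ∈ L) (h : E ⊆ F) :
    basic L E ⊆ basic L F := fun Y hY => Y.mem_of_superset hY hF h

theorem Wallman.basic_empty : basic L ∅ = ∅ :=
  eq_empty_of_forall_notMem fun Y hY => Y.empty_notMem hY

theorem Wallman.basic_univ : basic L univ = univ :=
  eq_univ_of_forall fun Y => Y.univ_mem

theorem Wallman.basic_inter {E F : Set X} (hE : E ∈ L) (hF : F ∈ L) :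
    basic L (E ∩ F) = basic L E ∩ basic L F := by
  ext Y
  exact ⟨fun h => ⟨Y.mem_of_superset h hE inter_subset_left,
    Y.mem_of_superset h hF inter_subset_right⟩, fun h => Y.inter_mem h.1 h.2⟩

/-- Maximal filters are prime: a member disjoint from `E` and a member disjoint from `F` meet in a
member disjoint from `E ∪ F`. -/
theorem Wallman.basic_union (hL : IsSetLattice L) {E F : Set X} (hE : E ∈ L) (hF : F ∈ L) :
    basic L (E ∪ F) = basic L E ∪ basic L F := by
  apply Subset.antisymm
  · intro Y hY
    by_contra h
    simp only [mem_union, not_or] at h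
    obtain ⟨E', hE', h1⟩ := Y.exists_disjoint hL hE h.1
    obtain ⟨F', hF', h2⟩ := Y.exists_disjoint hL hF h.2
    refine Y.empty_notMem ?_
    have := Y.inter_mem (Y.inter_mem hE' hF') hY
    convert this
    symm
    rw [eq_empty_iff_forall_notMem] at h1 h2 ⊢
    rintro x ⟨⟨hx1, hx2⟩, hx | hx⟩
    · exact h1 x ⟨hx1, hx⟩
    · exact h2 x ⟨hx2, hx⟩
  · exact union_subset (basic_mono (hL.union_mem hE hF) subset_union_left)
      (basic_mono (hL.union_mem hE hF) subset_union_right)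

/-- Each point of `X` defines a point of the Wallman extension. -/
def IsDisjunctive (L : Set (Set X)) : Prop :=
  ∀ x : X, ∃ Y : Wallman L, ∀ F ∈ L, F ∈ Y.sets ↔ x ∈ F

theorem Wallman.subset_of_basic_subset (hX : IsDisjunctive L) {E F : Set X} (hE : E ∈ L) (hF : F ∈ L) (h : basic L E ⊆ basic L F) : E ⊆ F := by
  intro x hx
  obtain ⟨Y, hY⟩ := hX x
  exact (hY F hF).1 (h ((hY E hE).2 hx))

theorem Wallman.disjoint_basic {E F : Set X} (hE : E ∈ L) (hF : F ∈ L) (h : Disjoint E F) :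
    Disjoint (basic L E) (basic L F) := by
  rw [disjoint_iff_inter_eq_empty, ← basic_inter hE hF, disjoint_iff_inter_eq_empty.1 h,
    basic_empty]

theorem Wallman.isClosed_basic {F : Set X} (hF : F ∈ L) : IsClosed (basic L F) :=
  ⟨TopologicalSpace.isOpen_generateFrom_of_mem ⟨F, hF, rfl⟩⟩

theorem Wallman.isTopologicalBasis (hL : IsSetLattice L) :
    TopologicalSpace.IsTopologicalBasis {U | ∃ F ∈ L, U = (basic L F)ᶜ} where
  exists_subset_inter := by
    rintro _ ⟨E, hE, rfl⟩ _ ⟨F, hF, rfl⟩ Y hY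
    refine ⟨_, ⟨E ∪ F, hL.union_mem hE hF, rfl⟩, ?_, ?_⟩
    · rw [basic_union hL hE hF, compl_union]
      exact hY
    · rw [basic_union hL hE hF, compl_union]
  sUnion_eq := eq_univ_of_forall fun Y =>
    ⟨univ, ⟨∅, hL.empty_mem, by rw [basic_empty, compl_empty]⟩, mem_univ _⟩
  eq_generateFrom := rfl

theorem Wallman.exists_of_notMem_isClosed (hL : IsSetLattice L) {K : Set (Wallman L)}
    (hK : IsClosed K) {Y : Wallman L} (hY : Y ∉ K) :
    ∃ F ∈ L, K ⊆ basic L F ∧ Y ∉ basic L F := by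
  obtain ⟨_, ⟨F, hF, rfl⟩, h1, h2⟩ :=
    (isTopologicalBasis hL).exists_subset_of_mem_open (show Y ∈ Kᶜ from hY) hK.isOpen_compl
  exact ⟨F, hF, compl_subset_compl.1 h2, h1⟩

/-- For an ultrafilter `U`, the sets whose basic sets belong to `U` form a proper filter in `L`. Any
maximal filter containing it is a limit of `U`, since a basic neighbourhood outside `U` would have
its complement in `U`. -/
theorem Wallman.compactSpace (hL : IsSetLattice L) : CompactSpace (Wallman L) := by
  refine ⟨isCompact_iff_ultrafilter_le_nhds.2 fun U _ => ?_⟩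
  let S : FilterIn L :=
    { sets := {F | F ∈ L ∧ basic L F ∈ U}
      subset_family := fun _ h => h.1
      univ_mem := ⟨hL.univ_mem, by rw [basic_univ]; exact univ_mem⟩
      inter_mem := fun E F hE hF => ⟨hL.inter_mem hE.1 hF.1, by
        rw [basic_inter hE.1 hF.1]
        exact inter_mem hE.2 hF.2⟩
      mem_of_superset := fun E F hE hF h => ⟨hF, mem_of_superset hE.2 (basic_mono hF h)⟩ }
  obtain ⟨Y, hY⟩ := S.exists_wallman fun h => by
    have := h.2
    rw [basic_empty] at this
    exact U.empty_notMem this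
  refine ⟨Y, mem_univ _, ?_⟩
  change (U : Filter (Wallman L)) ≤ @nhds _ (TopologicalSpace.generateFrom _) Y
  rw [TopologicalSpace.nhds_generateFrom]
  refine le_iInf₂ ?_
  rintro _ ⟨hYF, F, hF, rfl⟩
  rw [le_principal_iff]
  refine (Ultrafilter.compl_mem_iff_notMem (f := U)).2 fun h => hYF (hY ⟨hF, h⟩)

/-- A filter whose basic sets have intersection disjoint from a basic set has a member
disjoint from it. -/
theorem FilterIn.exists_disjoint_of_iInter (hL : IsSetLattice L) (S : FilterIn L) {K : Set X}
    (hK : K ∈ L) (h : (⋂ F ∈ S.sets, Wallman.basic L F) ∩ Wallman.basic L K = ∅) :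
    ∃ F ∈ S.sets, Disjoint F K := by
  by_contra! H
  -- If all members meet `K`, the trace on `K` is proper, and a maximal filter above it is a point
  -- of the supposedly empty intersection.
  obtain ⟨Y, hY⟩ := (S.trace hL K).exists_wallman (by
    rintro ⟨-, E, hE, hEK⟩
    exact H E hE (disjoint_iff_inter_eq_empty.2 (subset_empty_iff.1 hEK)))
  have : Y ∈ (⋂ F ∈ S.sets, Wallman.basic L F) ∩ Wallman.basic L K := by
    refine ⟨mem_iInter₂.2 fun F hF => hY ⟨S.subset_family hF, F, hF, inter_subset_left⟩,
      hY ⟨hK, univ, S.univ_mem, inter_subset_right⟩⟩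
  rw [h] at this
  exact this

/-- The filter of all members of `L` whose basic set contains `K`. -/
def Wallman.hullFilter (hL : IsSetLattice L) (K : Set (Wallman L)) : FilterIn L where
  sets := {F | F ∈ L ∧ K ⊆ basic L F}
  subset_family := fun _ h => h.1
  univ_mem := ⟨hL.univ_mem, by rw [basic_univ]; exact subset_univ _⟩
  inter_mem := fun E F hE hF => ⟨hL.inter_mem hE.1 hF.1, by
    rw [basic_inter hE.1 hF.1]
    exact subset_inter hE.2 hF.2⟩
  mem_of_superset := fun E F hE hF h => ⟨hF, hE.2.trans (basic_mono hF h)⟩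

theorem Wallman.iInter_hullFilter (hL : IsSetLattice L) {K : Set (Wallman L)} (hK : IsClosed K) :
    ⋂ F ∈ (hullFilter hL K).sets, basic L F = K := by
  apply Subset.antisymm
  · intro Y hY
    by_contra h
    obtain ⟨F, hF, hKF, hYF⟩ := exists_of_notMem_isClosed hL hK h
    exact hYF (mem_iInter₂.1 hY F ⟨hF, hKF⟩)
  · exact subset_iInter₂ fun F hF => hF.2

variable {G : Type v} [Group G] [MulAction G X]

theorem Wallman.preimage_smul_basic [InvariantFamily G L] (g : G) {F : Set X} (hF : F ∈ L) :
    (fun Y : Wallman L => g • Y) ⁻¹' basic L F = basic L ((fun x => g • x) ⁻¹' F) := by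
  ext Y
  exact ⟨fun h => h.2, fun h => ⟨hF, h⟩⟩

theorem Wallman.continuousConstSMul [InvariantFamily G L] :
    ContinuousConstSMul G (Wallman L) where
  continuous_const_smul g := by
    refine continuous_generateFrom_iff.2 ?_
    rintro _ ⟨F, hF, rfl⟩
    rw [preimage_compl, preimage_smul_basic g hF]
    exact (isClosed_basic (InvariantFamily.preimage_mem g hF)).isOpen_compl

end WallmanTopology

/-! ### Closures of subsets of `X` in the Wallman space -/

section Embedding

variable {X : Type u} [TopologicalSpace X] [T1Space X] (k : ClosedKind)

theorem preimage_toWallman_basic {F : Set X} (hF : F ∈ closedFamily X k) :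
    toWallman k ⁻¹' Wallman.basic _ F = F := by
  ext x
  exact ⟨fun h => h.2, fun h => ⟨hF, h⟩⟩

theorem closure_image_toWallman {F : Set X} (hF : F ∈ closedFamily X k) :
    closure (toWallman k '' F) = Wallman.basic _ F := by
  apply Subset.antisymm
  · refine closure_minimal ?_ (Wallman.isClosed_basic hF)
    rintro _ ⟨x, hx, rfl⟩
    exact ⟨hF, hx⟩
  · intro Y hY
    by_contra h
    obtain ⟨E, hE, hsub, hYE⟩ :=
      Wallman.exists_of_notMem_isClosed (isSetLattice_closedFamily k) isClosed_closure h
    refine hYE (Y.mem_of_superset hY hE fun x hx => ?_)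
    exact (hsub (subset_closure (mem_image_of_mem _ hx))).2

theorem iInter_closure_toWallman (S : FilterIn (closedFamily X k)) :
    ⋂ F ∈ S.sets, closure (toWallman k '' F) = ⋂ F ∈ S.sets, Wallman.basic _ F :=
  iInter₂_congr fun _ hF => closure_image_toWallman k (S.subset_family hF)

end Embedding

/-! ### Extending a nonnegative regular content to a Borel measure -/

section Content

variable {X : Type u} {L : Set (Set X)} {a : Set X → ℝ≥0∞}

/-- A finite, finitely additive, `L`-inner regular nonnegative set function on the algebra
generated by `L`. -/
structure IsRegularContent (L : Set (Set X)) (a : Set X → ℝ≥0∞) : Prop where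
  ne_top : ∀ A ∈ generateSetAlgebra L, a A ≠ ⊤
  union : ∀ A ∈ generateSetAlgebra L, ∀ B ∈ generateSetAlgebra L, Disjoint A B →
    a (A ∪ B) = a A + a B
  regular : ∀ A ∈ generateSetAlgebra L, ∀ ε : ℝ≥0∞, 0 < ε → ∃ F ∈ L, F ⊆ A ∧ a (A \ F) < ε

theorem compl_mem_generateSetAlgebra {F : Set X} (hF : F ∈ L) : Fᶜ ∈ generateSetAlgebra L :=
  .compl _ (.base _ hF)

namespace IsRegularContent

variable (ha : IsRegularContent L a)
include ha

theorem empty : a ∅ = 0 := by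
  have h := ha.union ∅ .empty ∅ .empty (disjoint_empty ∅)
  rw [union_self] at h
  exact (ENNReal.add_right_inj (ha.ne_top ∅ .empty)).1 (h.symm.trans (add_zero _).symm)

theorem add_sdiff {A B : Set X} (hA : A ∈ generateSetAlgebra L) (hB : B ∈ generateSetAlgebra L)
    (h : A ⊆ B) : a A + a (B \ A) = a B := by
  rw [← ha.union A hA _ (isSetAlgebra_generateSetAlgebra.sdiff_mem hB hA) disjoint_sdiff_right,
    union_sdiff_cancel h]

theorem mono {A B : Set X} (hA : A ∈ generateSetAlgebra L) (hB : B ∈ generateSetAlgebra L)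
    (h : A ⊆ B) : a A ≤ a B := by
  rw [← ha.add_sdiff hA hB h]
  exact le_self_add

theorem union_le {A B : Set X} (hA : A ∈ generateSetAlgebra L) (hB : B ∈ generateSetAlgebra L) :
    a (A ∪ B) ≤ a A + a B := by
  rw [← union_sdiff_self, ha.union A hA _
    (isSetAlgebra_generateSetAlgebra.sdiff_mem hB hA) disjoint_sdiff_right]
  gcongr
  exact ha.mono (isSetAlgebra_generateSetAlgebra.sdiff_mem hB hA) hB sdiff_subset

theorem biUnion_le {ι : Type*} (s : Finset ι) {f : ι → Set X}
    (hf : ∀ i, f i ∈ generateSetAlgebra L) : a (⋃ i ∈ s, f i) ≤ ∑ i ∈ s, a (f i) := by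
  classical
  induction s using Finset.induction_on with
  | empty => simp [ha.empty]
  | insert i s hi ih =>
    rw [Finset.set_biUnion_insert, Finset.sum_insert hi]
    exact (ha.union_le (hf i)
      (isSetAlgebra_generateSetAlgebra.biUnion_mem s fun j _ => hf j)).trans (by gcongr)

end IsRegularContent

/-- The value of the content `a` on an open subset of the Wallman extension. -/
noncomputable def openContent (L : Set (Set X)) (a : Set X → ℝ≥0∞) (U : Set (Wallman L)) : ℝ≥0∞ :=
  ⨆ F : {F : Set X // F ∈ L ∧ (Wallman.basic L F)ᶜ ⊆ U}, a F.1ᶜ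

theorem le_openContent {U : Set (Wallman L)} {F : Set X} (hF : F ∈ L)
    (h : (Wallman.basic L F)ᶜ ⊆ U) : a Fᶜ ≤ openContent L a U :=
  le_iSup (fun F : {F : Set X // F ∈ L ∧ (Wallman.basic L F)ᶜ ⊆ U} => a F.1ᶜ) ⟨F, hF, h⟩

theorem openContent_mono {U V : Set (Wallman L)} (h : U ⊆ V) :
    openContent L a U ≤ openContent L a V :=
  iSup_le fun F => le_openContent F.2.1 (F.2.2.trans h)

variable (hL : IsSetLattice L) (hX : IsDisjunctive L) (ha : IsRegularContent L a)
include hL hX ha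

omit hL in
theorem openContent_compl_basic {F : Set X} (hF : F ∈ L) :
    openContent L a (Wallman.basic L F)ᶜ = a Fᶜ := by
  refine le_antisymm (iSup_le fun E => ?_) (le_openContent hF Subset.rfl)
  refine ha.mono (compl_mem_generateSetAlgebra E.2.1) (compl_mem_generateSetAlgebra hF) ?_
  exact compl_subset_compl.2
    (Wallman.subset_of_basic_subset hX hF E.2.1 (compl_subset_compl.1 E.2.2))

theorem openContent_empty : openContent L a ∅ = 0 := by
  have := openContent_compl_basic hX ha hL.univ_mem
  rwa [Wallman.basic_univ, compl_univ, compl_univ, ha.empty] at this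

theorem openContent_univ : openContent L a univ = a univ := by
  have := openContent_compl_basic hX ha hL.empty_mem
  rwa [Wallman.basic_empty, compl_empty, compl_empty] at this

/-- This is where compactness produces countable subadditivity. The basic open subsets of `U n` are
directed under union, so a single choice `φ` of one such subset for each `n` already covers the
basic set of `E`. Finitely many indices then suffice, and the cover is read off on the points of
`X`. -/
theorem le_tsum_openContent {U : ℕ → Set (Wallman L)} (hU : ∀ n, IsOpen (U n)) {E : Set X}
    (hE : E ∈ L) (h : Wallman.basic L E ⊆ ⋃ n, U n) : a E ≤ ∑' n, openContent L a (U n) := by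
  have := Wallman.compactSpace hL
  have hc : IsCompact (Wallman.basic L E) := (Wallman.isClosed_basic hE).isCompact
  have : ∀ n, Nonempty {H : Set X // H ∈ L ∧ (Wallman.basic L H)ᶜ ⊆ U n} := fun n =>
    ⟨⟨univ, hL.univ_mem, by rw [Wallman.basic_univ, compl_univ]; exact empty_subset _⟩⟩
  obtain ⟨φ, hφ⟩ := hc.elim_directed_cover
    (fun φ : (n : ℕ) → {H : Set X // H ∈ L ∧ (Wallman.basic L H)ᶜ ⊆ U n} =>
      ⋃ n, (Wallman.basic L (φ n).1)ᶜ)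
    (fun φ => isOpen_iUnion fun n => (Wallman.isClosed_basic (φ n).2.1).isOpen_compl)
    (by
      intro Y hY
      obtain ⟨n, hn⟩ := mem_iUnion.1 (h hY)
      obtain ⟨H, hH, hUH, hYH⟩ := Wallman.exists_of_notMem_isClosed hL (hU n).isClosed_compl
        (show Y ∉ (U n)ᶜ from fun h => h hn)
      -- Only the choice at the index `n` matters for covering `Y`; the other coordinates are
      -- arbitrary.
      refine mem_iUnion.2 ⟨fun i => if hi : i = n then ⟨H, hH, hi ▸ compl_subset_comm.1 hUH⟩
        else Classical.arbitrary _, mem_iUnion.2 ⟨n, ?_⟩⟩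
      simpa using hYH)
    (by
      intro φ ψ
      refine ⟨fun n => ⟨(φ n).1 ∩ (ψ n).1, hL.inter_mem (φ n).2.1 (ψ n).2.1, ?_⟩, ?_, ?_⟩
      · rw [Wallman.basic_inter (φ n).2.1 (ψ n).2.1, compl_inter]
        exact union_subset (φ n).2.2 (ψ n).2.2
      · exact iUnion_mono fun n => compl_subset_compl.2
          (Wallman.basic_mono (φ n).2.1 inter_subset_left)
      · exact iUnion_mono fun n => compl_subset_compl.2
          (Wallman.basic_mono (ψ n).2.1 inter_subset_right))
  obtain ⟨t, ht⟩ := hc.elim_finite_subcover _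
    (fun n => (Wallman.isClosed_basic (φ n).2.1).isOpen_compl) hφ
  have hEt : E ⊆ ⋃ n ∈ t, (φ n).1ᶜ := by
    intro x hx
    obtain ⟨Y, hY⟩ := hX x
    obtain ⟨n, hn, hYn⟩ := mem_iUnion₂.1 (ht ((hY E hE).2 hx))
    exact mem_iUnion₂.2 ⟨n, hn, fun h => hYn ((hY _ (φ n).2.1).2 h)⟩
  have hmem : ∀ n, (φ n).1ᶜ ∈ generateSetAlgebra L :=
    fun n => compl_mem_generateSetAlgebra (φ n).2.1
  calc a E ≤ a (⋃ n ∈ t, (φ n).1ᶜ) := ha.mono (.base _ hE)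
        (isSetAlgebra_generateSetAlgebra.biUnion_mem t fun n _ => hmem n) hEt
    _ ≤ ∑ n ∈ t, a (φ n).1ᶜ := ha.biUnion_le t hmem
    _ ≤ ∑ n ∈ t, openContent L a (U n) :=
        Finset.sum_le_sum fun n _ => le_openContent (φ n).2.1 (φ n).2.2
    _ ≤ _ := ENNReal.sum_le_tsum t

theorem openContent_iUnion_le {U : ℕ → Set (Wallman L)} (hU : ∀ n, IsOpen (U n)) :
    openContent L a (⋃ n, U n) ≤ ∑' n, openContent L a (U n) := by
  refine iSup_le fun F => ENNReal.le_of_forall_pos_le_add fun ε hε _ => ?_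
  obtain ⟨E, hE, hEF, h⟩ := ha.regular _ (compl_mem_generateSetAlgebra F.2.1) ε (by simpa using hε)
  rw [← ha.add_sdiff (.base _ hE) (compl_mem_generateSetAlgebra F.2.1) hEF]
  refine add_le_add (le_tsum_openContent hL hX ha hU hE (Subset.trans ?_ F.2.2)) h.le
  exact (Wallman.disjoint_basic hE F.2.1 (subset_compl_iff_disjoint_right.1 hEF)).subset_compl_right

/-- The Carathéodory inequality on an open test set `V`, with `c` standing for the outer measure of
`V \ U`. A set `Fᶜ` seen inside `V ∩ U` is replaced by some `E ⊆ Fᶜ` in `L` of nearly the same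
content. Any `Hᶜ` seen in `V` off the basic set of `E` is disjoint from `E`, and `E ∪ Hᶜ` lies in
`(F ∩ H)ᶜ`, which is seen inside `V`. -/
theorem openContent_inter_add_le {U V : Set (Wallman L)} (c : ℝ≥0∞)
    (hc : ∀ E ∈ L, Wallman.basic L E ⊆ U → c ≤ openContent L a (V ∩ (Wallman.basic L E)ᶜ)) :
    openContent L a (V ∩ U) + c ≤ openContent L a V := by
  have hne : ∀ U : Set (Wallman L), Nonempty {H : Set X // H ∈ L ∧ (Wallman.basic L H)ᶜ ⊆ U} :=
    fun U => ⟨⟨univ, hL.univ_mem, by rw [Wallman.basic_univ, compl_univ]; exact empty_subset _⟩⟩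
  have := hne (V ∩ U)
  rw [openContent, ENNReal.iSup_add]
  refine iSup_le fun F => ENNReal.le_of_forall_pos_le_add fun ε hε _ => ?_
  obtain ⟨E, hE, hEF, h⟩ := ha.regular _ (compl_mem_generateSetAlgebra F.2.1) ε (by simpa using hε)
  have hEF' : Wallman.basic L E ⊆ (Wallman.basic L F.1)ᶜ :=
    (Wallman.disjoint_basic hE F.2.1
      (subset_compl_iff_disjoint_right.1 hEF)).subset_compl_right
  rw [← ha.add_sdiff (.base _ hE) (compl_mem_generateSetAlgebra F.2.1) hEF, add_right_comm]
  refine add_le_add ?_ h.le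
  refine (add_le_add le_rfl (hc E hE (hEF'.trans (F.2.2.trans inter_subset_right)))).trans ?_
  have := hne (V ∩ (Wallman.basic L E)ᶜ)
  rw [openContent, ENNReal.add_iSup]
  refine iSup_le fun H => ?_
  have hEH : E ⊆ H.1 := Wallman.subset_of_basic_subset hX hE H.2.1
    (compl_subset_compl.1 (H.2.2.trans inter_subset_right))
  rw [← ha.union E (.base _ hE) _ (compl_mem_generateSetAlgebra H.2.1)
    (disjoint_compl_right_iff_subset.2 hEH)]
  have hFH := hL.inter_mem F.2.1 H.2.1
  refine (ha.mono (.union _ _ (.base _ hE) (compl_mem_generateSetAlgebra H.2.1))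
    (compl_mem_generateSetAlgebra hFH) ?_).trans (le_openContent hFH ?_)
  · rw [compl_inter]
    exact union_subset_union_left _ hEF
  · rw [Wallman.basic_inter F.2.1 H.2.1, compl_inter]
    exact union_subset (F.2.2.trans inter_subset_left) (H.2.2.trans inter_subset_left)

omit hL hX ha in
instance : MeasurableSpace (Wallman L) :=
  MeasurableSpace.generateFrom (closedFamily (Wallman L) .all)

omit hL hX ha in
theorem measurableSet_of_isClosed {K : Set (Wallman L)} (hK : IsClosed K) : MeasurableSet K :=
  MeasurableSpace.measurableSet_generateFrom hK

/-- A measure on the Wallman extension extends the content `a` and is regular. -/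
structure IsWallmanExtension (L : Set (Set X)) (a : Set X → ℝ≥0∞) (μ : Measure (Wallman L)) :
    Prop where
  finite : IsFiniteMeasure μ
  basic : ∀ F ∈ L, μ (Wallman.basic L F) = a F
  outer : ∀ K : Set (Wallman L), IsClosed K → ∀ ε : ℝ≥0∞, 0 < ε →
    ∃ F ∈ L, K ⊆ Wallman.basic L F ∧ μ (Wallman.basic L F \ K) < ε
  inner : ∀ A : Set (Wallman L), MeasurableSet A → ∀ ε : ℝ≥0∞, 0 < ε →
    ∃ K, IsClosed K ∧ K ⊆ A ∧ μ (A \ K) < ε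

/-- Each regular content on `X` extends to a regular Borel measure on the Wallman extension. -/
theorem exists_isWallmanExtension : ∃ μ : Measure (Wallman L), IsWallmanExtension L a μ := by
  let o : OuterMeasure (Wallman L) :=
    inducedOuterMeasure (P := IsOpen) (fun U _ => openContent L a U) isOpen_empty
      (openContent_empty hL hX ha)
  have PU : ∀ ⦃f : ℕ → Set (Wallman L)⦄, (∀ i, IsOpen (f i)) → IsOpen (⋃ i, f i) :=
    fun f hf => isOpen_iUnion hf
  have msU : ∀ ⦃f : ℕ → Set (Wallman L)⦄ (hf : ∀ i, IsOpen (f i)),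
      openContent L a (⋃ i, f i) ≤ ∑' i, openContent L a (f i) :=
    fun f hf => openContent_iUnion_le hL hX ha hf
  have mono : ∀ ⦃U V : Set (Wallman L)⦄ (_ : IsOpen U) (_ : IsOpen V), U ⊆ V →
      openContent L a U ≤ openContent L a V := fun U V _ _ h => openContent_mono h
  have oopen : ∀ U, IsOpen U → o U = openContent L a U := fun U hU =>
    inducedOuterMeasure_eq' PU msU mono hU
  -- It suffices to split open test sets, and only by the complements of closed sets.
  have hcar : (inferInstance : MeasurableSpace (Wallman L)) ≤ o.caratheodory := by
    refine MeasurableSpace.generateFrom_le fun K hK => ?_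
    have hK : IsClosed K := hK
    rw [← MeasurableSet.compl_iff]
    refine (inducedOuterMeasure_caratheodory PU msU mono _).2 fun V hV => ?_
    change o _ + o _ ≤ o V
    rw [oopen _ (hV.inter hK.isOpen_compl), oopen V hV]
    refine openContent_inter_add_le hL hX ha _ fun E hE hEK => ?_
    rw [← oopen _ (hV.inter (Wallman.isClosed_basic hE).isOpen_compl)]
    exact o.mono fun Y hY => ⟨hY.1, fun h => hY.2 (hEK h)⟩
  let μ : Measure (Wallman L) := o.toMeasure hcar
  have μo : ∀ A, MeasurableSet A → μ A = o A := fun A hA => toMeasure_apply o hcar hA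
  have mo : ∀ U : Set (Wallman L), IsOpen U → MeasurableSet U := fun U hU => by
    simpa using (measurableSet_of_isClosed hU.isClosed_compl).compl
  have μopen : ∀ U, IsOpen U → μ U = openContent L a U := fun U hU => by
    rw [μo U (mo U hU), oopen U hU]
  have huniv : (univ : Set X) ∈ generateSetAlgebra L := .base _ hL.univ_mem
  have hfin : IsFiniteMeasure μ := ⟨by
    rw [μopen _ isOpen_univ, openContent_univ hL hX ha]
    exact (ha.ne_top _ huniv).lt_top⟩
  refine ⟨μ, hfin, fun F hF => ?_, fun K hK ε hε => ?_, fun A hA ε hε => ?_⟩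
  · have h1 := measure_add_measure_compl (μ := μ)
      (measurableSet_of_isClosed (Wallman.isClosed_basic hF))
    rw [μopen _ isOpen_univ, openContent_univ hL hX ha,
      μopen _ (Wallman.isClosed_basic hF).isOpen_compl, openContent_compl_basic hX ha hF,
      ← ha.add_sdiff (.base _ hF) huniv (subset_univ _), ← compl_eq_univ_sdiff] at h1
    exact (ENNReal.add_left_inj (ha.ne_top _ (compl_mem_generateSetAlgebra hF))).1 h1
  · have h1 : openContent L a Kᶜ ≠ ⊤ := by
      rw [← μopen _ hK.isOpen_compl]
      exact measure_ne_top μ _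
    -- Outer regularity of `K` is the supremum defining the content of `Kᶜ`, read through
    -- complements.
    have h2 : ∃ F : {F : Set X // F ∈ L ∧ (Wallman.basic L F)ᶜ ⊆ Kᶜ},
        openContent L a Kᶜ < a F.1ᶜ + ε := by
      by_contra! H
      have hne : Nonempty {F : Set X // F ∈ L ∧ (Wallman.basic L F)ᶜ ⊆ Kᶜ} :=
        ⟨⟨univ, hL.univ_mem, by rw [Wallman.basic_univ, compl_univ]; exact empty_subset _⟩⟩
      refine (ENNReal.lt_add_right h1 hε.ne').not_ge ?_
      conv_lhs => rw [openContent, ENNReal.iSup_add]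
      exact iSup_le H
    obtain ⟨F, hF⟩ := h2
    refine ⟨F.1, F.2.1, compl_subset_compl.1 F.2.2, ?_⟩
    have h3 : Wallman.basic L F.1 \ K = Kᶜ \ (Wallman.basic L F.1)ᶜ := by
      ext Y
      simp [and_comm]
    have hFo := (Wallman.isClosed_basic F.2.1).isOpen_compl
    rw [h3, measure_sdiff F.2.2 (mo _ hFo).nullMeasurableSet (measure_ne_top μ _),
      μopen _ hK.isOpen_compl, μopen _ hFo, openContent_compl_basic hX ha F.2.1]
    exact ENNReal.sub_lt_of_lt_add (le_openContent F.2.1 F.2.2) (by rwa [add_comm])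
  · have h1 : inducedOuterMeasure (P := IsOpen) (fun U _ => openContent L a U) isOpen_empty
      (openContent_empty hL hX ha) Aᶜ ≠ ⊤ := by
      change o Aᶜ ≠ ⊤
      rw [← μo _ hA.compl]
      exact measure_ne_top μ _
    obtain ⟨δ, hδ0, hδε⟩ := exists_between hε
    -- The inner closed set for `A` is the complement of an open set that approximates `Aᶜ` from
    -- outside.
    obtain ⟨U, hU, hAU, h⟩ := inducedOuterMeasure_exists_set PU msU mono h1 hδ0.ne'
    change o U ≤ o Aᶜ + δ at h
    rw [← μo _ hA.compl, ← μo _ (mo U hU)] at h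
    refine ⟨Uᶜ, hU.isClosed_compl, compl_subset_comm.1 hAU, ?_⟩
    have h3 : A \ Uᶜ = U \ Aᶜ := by
      ext Y
      simp [and_comm]
    rw [h3, measure_sdiff hAU hA.compl.nullMeasurableSet (measure_ne_top μ _)]
    exact (tsub_le_iff_left.2 h).trans_lt hδε

end Content

/-! ### Extending a complex regular measure, with control of its variation -/

section Extension

variable {X : Type u} {L : Set (Set X)}

theorem RegularMeasure.isRegularContent_variation (m : RegularMeasure L) :
    IsRegularContent L (variation L m) where
  ne_top A _ := m.variation_ne_top A
  union _ hA _ hB h := variation_union m.isAdditiveOn hA hB h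
  regular _ hA _ hε := m.variation_regular hA hε

/-- The nonnegative set function `|m| + r`. -/
noncomputable def shiftedVariation (m : RegularMeasure L) (r : Set X → ℝ) (A : Set X) : ℝ≥0∞ :=
  ENNReal.ofReal ((variation L m A).toReal + r A)

section Shift

variable {m : RegularMeasure L} {r : Set X → ℝ}

theorem shiftedVariation_le (hr : ∀ A ∈ generateSetAlgebra L, |r A| ≤ (variation L m A).toReal)
    {A : Set X} (hA : A ∈ generateSetAlgebra L) :
    shiftedVariation m r A ≤ 2 * variation L m A := by
  have e : 2 * variation L m A = ENNReal.ofReal (2 * (variation L m A).toReal) := by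
    rw [ENNReal.ofReal_mul zero_le_two, ENNReal.ofReal_ofNat,
      ENNReal.ofReal_toReal (m.variation_ne_top A)]
  rw [e]
  refine ENNReal.ofReal_le_ofReal ?_
  linarith [(le_abs_self _).trans (hr A hA)]

theorem toReal_shiftedVariation
    (hr : ∀ A ∈ generateSetAlgebra L, |r A| ≤ (variation L m A).toReal)
    {A : Set X} (hA : A ∈ generateSetAlgebra L) :
    (shiftedVariation m r A).toReal = (variation L m A).toReal + r A :=
  ENNReal.toReal_ofReal (by linarith [(neg_le_abs _).trans (hr A hA)])

theorem isRegularContent_shiftedVariation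
    (hr : ∀ A ∈ generateSetAlgebra L, |r A| ≤ (variation L m A).toReal)
    (hadd : ∀ A ∈ generateSetAlgebra L, ∀ B ∈ generateSetAlgebra L, Disjoint A B →
      r (A ∪ B) = r A + r B) : IsRegularContent L (shiftedVariation m r) where
  ne_top A _ := ENNReal.ofReal_ne_top
  union A hA B hB h := by
    have hA' := (neg_le_abs _).trans (hr A hA)
    have hB' := (neg_le_abs _).trans (hr B hB)
    rw [shiftedVariation, shiftedVariation, shiftedVariation,
      ← ENNReal.ofReal_add (by linarith) (by linarith), hadd A hA B hB h,
      variation_union m.isAdditiveOn hA hB h,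
      ENNReal.toReal_add (m.variation_ne_top A) (m.variation_ne_top B)]
    congr 1
    ring
  regular A hA ε hε := by
    obtain ⟨F, hF, hFA, h⟩ := m.variation_regular hA (ENNReal.half_pos hε.ne')
    refine ⟨F, hF, hFA, ?_⟩
    refine (shiftedVariation_le hr
      (isSetAlgebra_generateSetAlgebra.sdiff_mem hA (.base _ hF))).trans_lt ?_
    rwa [mul_comm, ← ENNReal.lt_div_iff_mul_lt (by simp) (by simp)]

end Shift

theorem measurableSet_of_mem_generateSetAlgebra {A : Set (Wallman L)}
    (hA : A ∈ generateSetAlgebra (closedFamily (Wallman L) .all)) : MeasurableSet A := by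
  change MeasurableSet[MeasurableSpace.generateFrom (closedFamily (Wallman L) .all)] A
  rw [← generateFrom_generateSetAlgebra_eq]
  exact MeasurableSpace.measurableSet_generateFrom hA

/-- The comparison of contents on `L` passes to closed sets by outer regularity of `μ`, then to
Borel sets by inner regularity of `ν`. -/
theorem IsWallmanExtension.le_two_mul {a b : Set X → ℝ≥0∞} {μ ν : Measure (Wallman L)}
    (hμ : IsWallmanExtension L a μ) (hν : IsWallmanExtension L b ν)
    (h : ∀ F ∈ L, b F ≤ 2 * a F) {A : Set (Wallman L)} (hA : MeasurableSet A) :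
    ν A ≤ 2 * μ A := by
  have := hμ.finite
  have hK : ∀ K : Set (Wallman L), IsClosed K → ν K ≤ 2 * μ K := by
    intro K hK
    refine ENNReal.le_of_forall_pos_le_add fun ε hε _ => ?_
    obtain ⟨F, hF, hKF, hlt⟩ := hμ.outer K hK (ε / 2 : NNReal)
      (ENNReal.coe_pos.2 (by positivity))
    have h2 : (2 : ℝ≥0∞) * ((ε / 2 : NNReal) : ℝ≥0∞) = ε := by
      rw [← ENNReal.coe_ofNat, ← ENNReal.coe_mul, mul_div_cancel₀ ε two_ne_zero]
    calc ν K ≤ ν (Wallman.basic L F) := measure_mono hKF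
      _ ≤ 2 * μ (Wallman.basic L F) := by
          rw [hμ.basic F hF, hν.basic F hF]
          exact h F hF
      _ ≤ 2 * (μ K + (ε / 2 : NNReal)) := by
          gcongr
          refine (measure_mono (t := K ∪ (Wallman.basic L F \ K)) ?_).trans
            ((measure_union_le _ _).trans (by gcongr))
          rw [union_sdiff_self]
          exact subset_union_right
      _ = 2 * μ K + ε := by rw [mul_add, h2]
  refine ENNReal.le_of_forall_pos_le_add fun ε hε _ => ?_
  obtain ⟨K, hKc, hKA, hlt⟩ := hν.inner A hA ε (by simpa using hε)
  calc ν A ≤ ν K + ν (A \ K) := by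
        refine (measure_mono (t := K ∪ (A \ K)) ?_).trans (measure_union_le _ _)
        rw [union_sdiff_self]
        exact subset_union_right
    _ ≤ 2 * μ A + ε := add_le_add ((hK K hKc).trans (by gcongr)) hlt.le

/-- The measure `p` on the Wallman extension, with variation `μ`, extends `m`. -/
structure IsExtension (m : RegularMeasure L) (p : RegularMeasure (closedFamily (Wallman L) .all))
    (μ : Measure (Wallman L)) : Prop where
  wallman : IsWallmanExtension L (variation L m) μ
  basic : ∀ F ∈ L, p (Wallman.basic L F) = m F
  variation_eq : ∀ A ∈ generateSetAlgebra (closedFamily (Wallman L) .all),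
    variation (closedFamily (Wallman L) .all) p A = μ A

section Domination

variable {m : RegularMeasure L} {μ : Measure (Wallman L)}
  (hμ : IsWallmanExtension L (variation L m) μ) {q : Set (Wallman L) → ℂ}
  (hadd : ∀ A B, MeasurableSet A → MeasurableSet B → Disjoint A B → q (A ∪ B) = q A + q B)
  (hbas : ∀ F ∈ L, q (Wallman.basic L F) = m F)
include hμ hadd hbas

/-- A crude bound improves itself to constant 1. The constant `c` only enters on the small sets
separating `A` from a closed set and that closed set from a basic set; on the basic set, `q` equals
`m`, which is bounded by `|m|` itself. -/
theorem IsWallmanExtension.norm_le {c : ℝ} (hc : 0 ≤ c)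
    (hq : ∀ A, MeasurableSet A → ‖q A‖ ≤ c * μ.real A)
    {A : Set (Wallman L)} (hA : MeasurableSet A) : ‖q A‖ ≤ μ.real A := by
  have := hμ.finite
  have step : ∀ {K B : Set (Wallman L)} {ε : ℝ}, MeasurableSet K → MeasurableSet B → K ⊆ B →
      μ (B \ K) < ENNReal.ofReal ε → ‖q B - q K‖ ≤ c * ε ∧ μ.real B ≤ μ.real K + ε := by
    intro K B ε hK hB hKB h
    have h0 : 0 ≤ ε := by
      by_contra h0
      rw [ENNReal.ofReal_of_nonpos (not_le.1 h0).le] at h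
      exact not_lt_zero h
    have hr : μ.real (B \ K) ≤ ε := ENNReal.toReal_le_of_le_ofReal h0 h.le
    have e1 := hadd K (B \ K) hK (hB.diff hK) disjoint_sdiff_right
    rw [union_sdiff_cancel hKB] at e1
    have e2 := measureReal_union (μ := μ) (disjoint_sdiff_right (s := K) (t := B)) (hB.diff hK)
    rw [union_sdiff_cancel hKB] at e2
    refine ⟨?_, by linarith⟩
    rw [e1, add_sub_cancel_left]
    exact (hq _ (hB.diff hK)).trans (by gcongr)
  refine le_of_forall_pos_le_add fun ε hε => ?_
  -- Two approximation errors cost `c * δ` each, and the outer basic set exceeds the closed set by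
  -- at most `δ` in measure.
  obtain ⟨δ, hδ, hδε⟩ : ∃ δ : ℝ, 0 < δ ∧ (2 * c + 1) * δ ≤ ε :=
    ⟨ε / (2 * c + 1), by positivity, (mul_div_cancel₀ ε (by positivity)).le⟩
  obtain ⟨K, hK, hKA, h1⟩ := hμ.inner A hA (ENNReal.ofReal δ) (by simpa using hδ)
  obtain ⟨F, hF, hKF, h2⟩ := hμ.outer K hK (ENNReal.ofReal δ) (by simpa using hδ)
  have mK := measurableSet_of_isClosed hK
  have mF := measurableSet_of_isClosed (Wallman.isClosed_basic hF)
  obtain ⟨s1, s2⟩ := step mK hA hKA h1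
  obtain ⟨s3, s4⟩ := step mK mF hKF h2
  have h3 : ‖q (Wallman.basic L F)‖ ≤ μ.real (Wallman.basic L F) := by
    rw [hbas F hF, measureReal_def, hμ.basic F hF]
    exact m.norm_le_variation (.base _ hF)
  have h4 : ‖q A‖ ≤ ‖q A - q K‖ + ‖q (Wallman.basic L F) - q K‖ + ‖q (Wallman.basic L F)‖ := by
    have : q A = (q A - q K) - (q (Wallman.basic L F) - q K) + q (Wallman.basic L F) := by ring
    calc ‖q A‖ = ‖(q A - q K) - (q (Wallman.basic L F) - q K) + q (Wallman.basic L F)‖ := by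
          rw [← this]
      _ ≤ _ := (norm_add_le _ _).trans (by gcongr; exact norm_sub_le _ _)
  have h5 : μ.real K ≤ μ.real A := measureReal_mono hKA
  linarith

open Classical in
-- The bound on `q` gives regularity and `|p| ≤ μ`. For equality it is enough to compare total
-- masses, since both sides are additive and finite. A partition of `X` is shrunk to disjoint
-- members of `L`, whose basic sets are disjoint and carry the same values, so `|p|` has at least
-- the total mass of `|m|`.
theorem IsWallmanExtension.exists_isExtension (hL : IsSetLattice L)
    (hq : ∀ A, MeasurableSet A → ‖q A‖ ≤ μ.real A) : ∃ p, IsExtension m p μ := by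
  have := hμ.finite
  let C := generateSetAlgebra (closedFamily (Wallman L) .all)
  have hC : IsSetAlgebra C := isSetAlgebra_generateSetAlgebra
  have qe : ∀ A, MeasurableSet A → ‖q A‖ₑ ≤ μ A := fun A hA => by
    rw [← ofReal_norm, ← ENNReal.ofReal_toReal (measure_ne_top μ A)]
    exact ENNReal.ofReal_le_ofReal (hq A hA)
  let p : RegularMeasure (closedFamily (Wallman L) .all) :=
    { toFun := fun A => if A ∈ C then q A else 0
      eq_zero_of_notMem := fun A hA => if_neg hA
      additive := fun A hA B hB h => by
        rw [if_pos (hC.union_mem hA hB), if_pos (show A ∈ C from hA), if_pos (show B ∈ C from hB),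
          hadd A B (measurableSet_of_mem_generateSetAlgebra hA)
            (measurableSet_of_mem_generateSetAlgebra hB) h]
      bounded := ⟨μ.real univ, fun A hA => by
        rw [if_pos (show A ∈ C from hA)]
        exact (hq A (measurableSet_of_mem_generateSetAlgebra hA)).trans
          (measureReal_mono (subset_univ _))⟩
      regular := fun A hA ε hε => by
        obtain ⟨K, hK, hKA, h⟩ := hμ.inner A (measurableSet_of_mem_generateSetAlgebra hA)
          (ENNReal.ofReal ε) (by simpa using hε)
        refine ⟨K, hK, hKA, fun B hB hBA => ?_⟩
        rw [if_pos (show B ∈ C from hB)]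
        refine (hq B (measurableSet_of_mem_generateSetAlgebra hB)).trans_lt ?_
        refine (measureReal_mono hBA).trans_lt ?_
        exact (ENNReal.lt_ofReal_iff_toReal_lt (measure_ne_top μ _)).1 h }
  have pq : ∀ A ∈ C, p A = q A := fun A hA => if_pos hA
  have hbC : ∀ F ∈ L, Wallman.basic L F ∈ C := fun F hF => .base _ (Wallman.isClosed_basic hF)
  have hle : ∀ A ∈ C, variation (closedFamily (Wallman L) .all) p A ≤ μ A := by
    intro A _
    refine variation_le fun P hP hd => ?_
    have hmP : ∀ B ∈ P, MeasurableSet B := fun B hB =>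
      measurableSet_of_mem_generateSetAlgebra (hP B hB).1
    calc ∑ B ∈ P, ‖p B‖ₑ ≤ ∑ B ∈ P, μ B := Finset.sum_le_sum fun B hB => by
          rw [pq B (hP B hB).1]
          exact qe B (hmP B hB)
      _ = μ (⋃ B ∈ P, B) := (measure_biUnion_finset hd hmP).symm
      _ ≤ μ A := measure_mono (iUnion₂_subset fun B hB => (hP B hB).2)
  have hge : μ univ ≤ variation (closedFamily (Wallman L) .all) p univ := by
    rw [← Wallman.basic_univ, hμ.basic _ hL.univ_mem, Wallman.basic_univ]
    refine variation_le fun P hP hd => ?_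
    refine ENNReal.le_of_forall_pos_le_add fun ε hε _ => ?_
    obtain ⟨δ, hδ, hδε⟩ : ∃ δ : NNReal, 0 < δ ∧ P.card * δ ≤ ε := by
      refine ⟨ε / (P.card + 1), by positivity, ?_⟩
      rw [mul_div_left_comm]
      refine mul_le_of_le_one_right zero_le ?_
      exact (div_le_one (by positivity)).2 (by simp)
    have hreg : ∀ B : Set X, ∃ F, B ∈ P → F ∈ L ∧ F ⊆ B ∧ variation L m (B \ F) < δ := by
      intro B
      by_cases hB : B ∈ P
      · obtain ⟨F, h1, h2, h3⟩ := m.variation_regular (hP B hB).1 (ε := δ) (by simpa using hδ)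
        exact ⟨F, fun _ => ⟨h1, h2, h3⟩⟩
      · exact ⟨∅, fun h => absurd h hB⟩
    choose F hF using hreg
    have hterm : ∀ B ∈ P, ‖m B‖ₑ ≤ ‖p (Wallman.basic L (F B))‖ₑ + δ := by
      intro B hB
      obtain ⟨h1, h2, h3⟩ := hF B hB
      have hd' : B \ F B ∈ generateSetAlgebra L :=
        isSetAlgebra_generateSetAlgebra.sdiff_mem (hP B hB).1 (.base _ h1)
      have e := m.additive (F B) (.base _ h1) _ hd' disjoint_sdiff_right
      rw [union_sdiff_cancel h2] at e
      rw [pq _ (hbC _ h1), hbas _ h1, e]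
      exact (enorm_add_le _ _).trans
        (add_le_add le_rfl ((enorm_le_variation m.empty hd' Subset.rfl).trans h3.le))
    calc ∑ B ∈ P, ‖m B‖ₑ ≤ ∑ B ∈ P, (‖p (Wallman.basic L (F B))‖ₑ + δ) :=
          Finset.sum_le_sum hterm
      _ = ∑ B ∈ P, ‖p (Wallman.basic L (F B))‖ₑ + P.card * δ := by
          rw [Finset.sum_add_distrib, Finset.sum_const, nsmul_eq_mul]
      _ ≤ _ := by
          refine add_le_add (sum_le_variation p.empty P (f := fun B => Wallman.basic L (F B))
            (fun B hB => ⟨hbC _ (hF B hB).1, subset_univ _⟩) ?_) (by exact_mod_cast hδε)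
          intro B hB B' hB' hne
          exact Wallman.disjoint_basic (hF B hB).1 (hF B' hB').1
            ((hd hB hB' hne).mono (hF B hB).2.1 (hF B' hB').2.1)
  refine ⟨p, hμ, fun F hF => by rw [pq _ (hbC F hF), hbas F hF], fun A hA => ?_⟩
  refine le_antisymm (hle A hA) ?_
  have hA' : Aᶜ ∈ C := hC.compl_mem hA
  have h1 := measure_add_measure_compl (μ := μ) (measurableSet_of_mem_generateSetAlgebra hA)
  have h2 := variation_union p.isAdditiveOn hA hA' disjoint_compl_right
  rw [union_compl_self] at h2
  rw [h2, ← h1] at hge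
  exact (ENNReal.add_le_add_iff_right (measure_ne_top μ Aᶜ)).1
    (hge.trans (add_le_add le_rfl (hle _ hA')))

end Domination

/-- Every regular measure on `X` extends to a regular measure on the Wallman extension. -/
theorem exists_isExtension (hL : IsSetLattice L) (hX : IsDisjunctive L) (m : RegularMeasure L) :
    ∃ p μ, IsExtension m p μ := by
  have hre : ∀ A ∈ generateSetAlgebra L, |(m A).re| ≤ (variation L m A).toReal := fun A hA =>
    (Complex.abs_re_le_norm _).trans (m.norm_le_variation hA)
  have him : ∀ A ∈ generateSetAlgebra L, |(m A).im| ≤ (variation L m A).toReal := fun A hA =>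
    (Complex.abs_im_le_norm _).trans (m.norm_le_variation hA)
  obtain ⟨μ, hμ⟩ := exists_isWallmanExtension hL hX m.isRegularContent_variation
  obtain ⟨α, hα⟩ := exists_isWallmanExtension hL hX
    (isRegularContent_shiftedVariation (r := fun A => (m A).re) hre
      fun A hA B hB h => by rw [m.additive A hA B hB h, Complex.add_re])
  obtain ⟨β, hβ⟩ := exists_isWallmanExtension hL hX
    (isRegularContent_shiftedVariation (r := fun A => (m A).im) him
      fun A hA B hB h => by rw [m.additive A hA B hB h, Complex.add_im])
  have := hμ.finite
  have := hα.finite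
  have := hβ.finite
  have dom : ∀ {ν : Measure (Wallman L)} {r : Set X → ℝ},
      IsWallmanExtension L (shiftedVariation m r) ν →
      (∀ A ∈ generateSetAlgebra L, |r A| ≤ (variation L m A).toReal) →
      ∀ A, MeasurableSet A → |ν.real A - μ.real A| ≤ 2 * μ.real A := by
    intro ν r hν hr A hA
    have h1 := hμ.le_two_mul hν (fun F hF => shiftedVariation_le hr (.base _ hF)) hA
    have h2 : ν.real A ≤ 2 * μ.real A := by
      have := ENNReal.toReal_mono (by finiteness) h1
      simpa [measureReal_def] using this
    have h3 : 0 ≤ ν.real A := measureReal_nonneg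
    have h4 : 0 ≤ μ.real A := measureReal_nonneg
    rw [abs_le]
    constructor <;> linarith
  -- The shift by `|m|` that made the real and imaginary parts nonnegative is subtracted again.
  let q : Set (Wallman L) → ℂ := fun A => ⟨α.real A - μ.real A, β.real A - μ.real A⟩
  have hadd : ∀ A B, MeasurableSet A → MeasurableSet B → Disjoint A B →
      q (A ∪ B) = q A + q B := by
    intro A B _ hB h
    apply Complex.ext
    · have h1 := measureReal_union (μ := α) h hB
      have h2 := measureReal_union (μ := μ) h hB
      simp only [q, Complex.add_re, h1, h2]
      ring
    · have h1 := measureReal_union (μ := β) h hB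
      have h2 := measureReal_union (μ := μ) h hB
      simp only [q, Complex.add_im, h1, h2]
      ring
  have hbas : ∀ F ∈ L, q (Wallman.basic L F) = m F := by
    intro F hF
    apply Complex.ext
    · simp only [q, measureReal_def, hα.basic F hF, hμ.basic F hF,
        toReal_shiftedVariation hre (.base _ hF), add_sub_cancel_left]
    · simp only [q, measureReal_def, hβ.basic F hF, hμ.basic F hF,
        toReal_shiftedVariation him (.base _ hF), add_sub_cancel_left]
  have hq : ∀ A, MeasurableSet A → ‖q A‖ ≤ 4 * μ.real A := by
    intro A hA
    refine (Complex.norm_le_abs_re_add_abs_im _).trans ?_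
    have h1 := dom hα hre A hA
    have h2 := dom hβ him A hA
    simp only [q]
    linarith
  obtain ⟨p, hp⟩ := hμ.exists_isExtension hadd hbas hL
    fun A hA => hμ.norm_le hadd hbas zero_le_four hq hA
  exact ⟨p, μ, hp⟩

end Extension

/-! ### Values on closed sets as limits along filters -/

section Limits

variable {X : Type u} {L : Set (Set X)}

theorem IsWallmanExtension.compl_basic {a : Set X → ℝ≥0∞} {μ : Measure (Wallman L)}
    (hμ : IsWallmanExtension L a μ) (ha : IsRegularContent L a) (hL : IsSetLattice L) {F : Set X}
    (hF : F ∈ L) : μ (Wallman.basic L F)ᶜ = a Fᶜ := by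
  have h1 := measure_add_measure_compl (μ := μ)
    (measurableSet_of_isClosed (Wallman.isClosed_basic hF))
  have hu := hμ.basic _ hL.univ_mem
  rw [Wallman.basic_univ] at hu
  rw [hu, hμ.basic F hF, ← ha.add_sdiff (.base _ hF) (.base _ hL.univ_mem) (subset_univ F),
    ← compl_eq_univ_sdiff] at h1
  exact (ENNReal.add_right_inj (ha.ne_top F (.base _ hF))).1 h1

variable {m : RegularMeasure L} {p : RegularMeasure (closedFamily (Wallman L) .all)}
  {μ : Measure (Wallman L)} (h : IsExtension m p μ)
include h

theorem IsExtension.norm_le {A : Set (Wallman L)}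
    (hA : A ∈ generateSetAlgebra (closedFamily (Wallman L) .all)) : ‖p A‖ ≤ μ.real A := by
  have := p.norm_le_variation hA
  rwa [h.variation_eq A hA] at this

/-- A basic set of `E` approximates `K` from outside, and some `N ∈ L` nearly fills `Eᶜ`. The basic
set of `N` misses `K`, so by compactness some member of `S` is disjoint from `N`. For smaller
members `H`, the basic set of `H` differs from `K` only within the basic set of `E` minus `K` and
within the leftover of `Eᶜ`; both are small. -/
theorem IsExtension.limit (hL : IsSetLattice L) (S : FilterIn L) {K : Set (Wallman L)}
    (hK : IsClosed K) (hS : ⋂ F ∈ S.sets, Wallman.basic L F = K) : S.Limit m (p K) := by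
  have := h.wallman.finite
  refine Metric.tendsto_nhds.2 fun ε hε => ?_
  have hε2 : 0 < ENNReal.ofReal (ε / 2) := by simpa using hε
  obtain ⟨E, hE, hKE, h1⟩ := h.wallman.outer K hK _ hε2
  obtain ⟨N, hN, hNE, h2⟩ := m.variation_regular (compl_mem_generateSetAlgebra hE) hε2
  have hdisj := Wallman.disjoint_basic hN hE (subset_compl_iff_disjoint_right.1 hNE)
  obtain ⟨F, hF, hFN⟩ := S.exists_disjoint_of_iInter hL hN (by
    rw [hS, ← disjoint_iff_inter_eq_empty]
    exact hdisj.symm.mono_left hKE)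
  refine (eventually_le_atBot (⟨F, hF⟩ : S.sets)).mono fun H hHF => ?_
  have hH := S.subset_family H.2
  have hHF : H.1 ⊆ F := hHF
  have hKH : K ⊆ Wallman.basic L H.1 := hS ▸ biInter_subset_of_mem H.2
  have hKm : K ∈ generateSetAlgebra (closedFamily (Wallman L) .all) := .base _ hK
  have hHm : Wallman.basic L H.1 ∈ generateSetAlgebra (closedFamily (Wallman L) .all) :=
    .base _ (Wallman.isClosed_basic hH)
  have hNE' := hL.union_mem hN hE
  have hsub : Wallman.basic L H.1 \ K ⊆
      (Wallman.basic L E \ K) ∪ (Wallman.basic L (N ∪ E))ᶜ := by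
    intro Y hY
    by_cases hYE : Y ∈ Wallman.basic L E
    · exact Or.inl ⟨hYE, hY.2⟩
    · refine Or.inr fun hYNE => ?_
      rw [Wallman.basic_union hL hN hE] at hYNE
      rcases hYNE with hYN | hYE'
      · exact disjoint_left.1 (Wallman.disjoint_basic hH hN (hFN.mono_left hHF)) hY.1 hYN
      · exact hYE hYE'
  have hlt : μ (Wallman.basic L H.1 \ K) < ENNReal.ofReal ε := by
    refine (measure_mono hsub).trans_lt ((measure_union_le _ _).trans_lt ?_)
    rw [h.wallman.compl_basic m.isRegularContent_variation hL hNE',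
      show (N ∪ E)ᶜ = Eᶜ \ N by rw [compl_union, inter_comm]; rfl]
    refine (ENNReal.add_lt_add h1 h2).trans_eq ?_
    rw [← ENNReal.ofReal_add (by positivity) (by positivity), add_halves]
  rw [dist_eq_norm, ← h.basic _ hH, ← p.isAdditiveOn.sdiff hHm hKm hKH]
  refine (h.norm_le (isSetAlgebra_generateSetAlgebra.sdiff_mem hHm hKm)).trans_lt ?_
  exact (ENNReal.lt_ofReal_iff_toReal_lt (measure_ne_top μ _)).1 hlt

omit h in
theorem FilterIn.limit_unique (S : FilterIn L) {n : Set X → ℂ} {c d : ℂ} (hc : S.Limit n c)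
    (hd : S.Limit n d) : c = d := by
  have : Nonempty S.sets := ⟨⟨univ, S.univ_mem⟩⟩
  have : IsCodirectedOrder S.sets := ⟨fun E F =>
    ⟨⟨E.1 ∩ F.1, S.inter_mem E.2 F.2⟩, inter_subset_left, inter_subset_right⟩⟩
  exact tendsto_nhds_unique hc hd

end Limits

/-! ### Transfer of quasi-invariance -/

section QuasiInvariance

variable {G : Type v} [Group G]

/-- One of the two absolute continuities is enough: the reverse one for `g` is the direct one for
`g⁻¹` applied to the translated set. -/
theorem isQuasiInvariant_iff {Y : Type u} [MulAction G Y] {L : Set (Set Y)} (m : RegularMeasure L)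
    (hG : ∀ (g : G), ∀ A ∈ generateSetAlgebra L, (fun y => g • y) ⁻¹' A ∈ generateSetAlgebra L) :
    IsQuasiInvariant G m ↔ ∀ (g : G) (ε : ℝ≥0∞), 0 < ε → ∃ δ : ℝ≥0∞, 0 < δ ∧
      ∀ A ∈ generateSetAlgebra L, variation L m A < δ →
        variation L m ((fun y => g • y) ⁻¹' A) < ε := by
  have e : ∀ g A, variation L (measureTranslate g m) A =
      variation L m ((fun y : Y => g • y) ⁻¹' A) :=
    variation_measureTranslate hG m.empty
  constructor
  · intro h g ε hε
    obtain ⟨δ, hδ, H⟩ := (h g).1 ε hε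
    exact ⟨δ, hδ, fun A hA hlt => e g A ▸ H A hA hlt⟩
  · refine fun h g => ⟨fun ε hε => ?_, fun ε hε => ?_⟩
    · obtain ⟨δ, hδ, H⟩ := h g ε hε
      exact ⟨δ, hδ, fun A hA hlt => (e g A).symm ▸ H A hA hlt⟩
    · obtain ⟨δ, hδ, H⟩ := h g⁻¹ ε hε
      refine ⟨δ, hδ, fun A hA hlt => ?_⟩
      rw [e g A] at hlt
      have := H _ (hG g A hA) hlt
      rw [preimage_smul_preimage] at this
      simpa using this

variable {X : Type u} [MulAction G X] {L : Set (Set X)} [InvariantFamily G L]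

variable (L) in
theorem preimage_smul_mem_generateSetAlgebra (g : G) (A : Set X) (hA : A ∈ generateSetAlgebra L) :
    (fun x => g • x) ⁻¹' A ∈ generateSetAlgebra L :=
  preimage_mem_generateSetAlgebra (fun _ hF => .base _ (InvariantFamily.preimage_mem g hF)) hA

theorem Wallman.invariantFamily_closed :
    InvariantFamily G (closedFamily (Wallman L) .all) := by
  have : ContinuousConstSMul G (Wallman L) := continuousConstSMul
  infer_instance

/-- A closed `K` nearly fills `g⁻¹A`, and its translate `gK ⊆ A` is enclosed in a basic set of some
`F` with `|m|(F) < δ`. Quasi-invariance of `m` makes `g⁻¹F` small, and the basic set of `g⁻¹F`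
contains `K`. -/
theorem IsExtension.isQuasiInvariant {m : RegularMeasure L}
    {p : RegularMeasure (closedFamily (Wallman L) .all)} {μ : Measure (Wallman L)}
    (h : IsExtension m p μ) (hm : IsQuasiInvariant G m) : IsQuasiInvariant G p := by
  have hinv : InvariantFamily G (closedFamily (Wallman L) .all) := Wallman.invariantFamily_closed
  have hG := preimage_smul_mem_generateSetAlgebra (G := G) (closedFamily (Wallman L) .all)
  have hcont : ContinuousConstSMul G (Wallman L) := Wallman.continuousConstSMul
  have hfin := h.wallman.finite
  refine (isQuasiInvariant_iff p hG).2 fun g ε hε => ?_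
  obtain ⟨ε', hε', hεε⟩ := exists_between hε
  have hε2 := ENNReal.half_pos hε'.ne'
  obtain ⟨δ, hδ, H⟩ := (isQuasiInvariant_iff m
    (preimage_smul_mem_generateSetAlgebra L)).1 hm g _ hε2
  refine ⟨δ, hδ, fun A hA hlt => ?_⟩
  rw [h.variation_eq A hA] at hlt
  rw [h.variation_eq _ (hG g A hA)]
  obtain ⟨K, hK, hKA, h1⟩ := h.wallman.inner _
    (measurableSet_of_mem_generateSetAlgebra (hG g A hA)) _ hε2
  have hgK : IsClosed ((fun Y : Wallman L => g⁻¹ • Y) ⁻¹' K) :=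
    hK.preimage (continuous_const_smul g⁻¹)
  have hgKA : (fun Y : Wallman L => g⁻¹ • Y) ⁻¹' K ⊆ A := fun Y hY => by
    simpa using hKA hY
  obtain ⟨F, hF, hKF, h2⟩ := h.wallman.outer _ hgK (δ - μ A) (tsub_pos_of_lt hlt)
  have h3 : variation L m F < δ := by
    rw [← h.wallman.basic F hF, ← sdiff_union_of_subset hKF]
    refine (measure_union_le _ _).trans_lt ?_
    refine (add_le_add le_rfl (measure_mono hgKA)).trans_lt ?_
    exact lt_tsub_iff_right.1 h2
  have h4 := H F (.base _ hF) h3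
  have hgF : (fun x : X => g • x) ⁻¹' F ∈ L := InvariantFamily.preimage_mem g hF
  rw [← h.wallman.basic _ hgF, ← Wallman.preimage_smul_basic g hF] at h4
  have h5 : K ⊆ (fun Y : Wallman L => g • Y) ⁻¹' Wallman.basic L F := fun Y hY => by
    change g • Y ∈ Wallman.basic L F
    exact hKF (by simpa using hY)
  refine lt_of_le_of_lt ?_ hεε
  rw [← sdiff_union_of_subset hKA, ← ENNReal.add_halves ε']
  exact (measure_union_le _ _).trans (add_le_add h1.le ((measure_mono h5).trans h4.le))

end QuasiInvariance

/-! ### Real measures and closed sets outside `X` -/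

section RealMeasures

variable {X : Type u} [TopologicalSpace X] [T1Space X] (k : ClosedKind)

theorem isDisjunctive_closedFamily : IsDisjunctive (closedFamily X k) :=
  fun x => ⟨toWallman k x, fun _ hF => ⟨fun h => h.2, fun h => ⟨hF, h⟩⟩⟩

variable {k}

theorem FilterIn.vanishing_iff (S : FilterIn (closedFamily X k)) :
    S.Vanishing ↔ ⋂ F ∈ S.sets, Wallman.basic _ F ⊆ (range (toWallman (X := X) k))ᶜ := by
  rw [subset_compl_comm, range_subset_iff, FilterIn.Vanishing, eq_empty_iff_forall_notMem]
  refine forall_congr' fun x => not_congr ?_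
  rw [mem_sInter, mem_iInter₂]
  exact forall₂_congr fun F hF => ⟨fun h => ⟨S.subset_family hF, h⟩, fun h => h.2⟩

/-- A filter vanishes exactly when its basic sets intersect outside `X`, and `IsExtension.limit`
identifies the limit of `m` along it with the value of `p` on that intersection. Each closed set
arises in this way from its hull filter. -/
theorem IsExtension.isRealMeasure_iff {m : RegularMeasure (closedFamily X k)}
    {p : RegularMeasure (closedFamily (Wallman (closedFamily X k)) .all)}
    {μ : Measure (Wallman (closedFamily X k))} (h : IsExtension m p μ) :
    IsRealMeasure m ↔ ∀ K : Set (Wallman (closedFamily X k)), IsClosed K →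
      K ⊆ (range (toWallman (X := X) k))ᶜ → p K = 0 := by
  have hL := isSetLattice_closedFamily (X := X) k
  constructor
  · intro hm K hK hKX
    have e := Wallman.iInter_hullFilter hL hK
    exact FilterIn.limit_unique _ (h.limit hL _ hK e)
      (hm _ ((FilterIn.vanishing_iff _).2 (by rwa [e])))
  · intro H S hS
    have hK : IsClosed (⋂ F ∈ S.sets, Wallman.basic (closedFamily X k) F) :=
      isClosed_biInter fun F hF => Wallman.isClosed_basic (S.subset_family hF)
    rw [← H _ hK (S.vanishing_iff.1 hS)]
    exact h.limit hL S hK rfl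

end RealMeasures

/-! ### Smooth measures: variation measure, polar decomposition, density of translates -/

section SigmaSmooth

variable {Y : Type u} {L : Set (Set Y)} {m : RegularMeasure L}

/-- A finite partition nearly attains `|m|(A 0)`. Removing `A n` from its pieces changes their
values by amounts tending to zero, so `A 0 \ A n` eventually carries all but `ε` of the variation.
-/
theorem IsSigmaSmooth.tendsto_variation (hm : IsSigmaSmooth m) {A : ℕ → Set Y}
    (hA : ∀ n, A n ∈ generateSetAlgebra L) (hanti : Antitone A) (hempty : ⋂ n, A n = ∅) :
    Tendsto (fun n => variation L m (A n)) atTop (𝓝 0) := by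
  have hC : IsSetAlgebra (generateSetAlgebra L) := isSetAlgebra_generateSetAlgebra
  refine ENNReal.tendsto_nhds_zero.2 fun ε hε => ?_
  by_cases h0 : variation L m (A 0) ≤ ε
  · exact Eventually.of_forall fun n => (variation_mono (hanti (Nat.zero_le n))).trans h0
  have hne := m.variation_ne_top (A 0)
  obtain ⟨P, hP, hd, hlt⟩ := exists_lt_sum_of_lt_variation
    (ENNReal.sub_lt_self hne (fun h => h0 (h ▸ zero_le)) hε.ne')
  have hlim : Tendsto (fun n => ∑ B ∈ P, ‖m (B \ A n)‖ₑ) atTop (𝓝 (∑ B ∈ P, ‖m B‖ₑ)) := by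
    refine tendsto_finsetSum P fun B hB => ?_
    have h1 : Tendsto (fun n => m (B ∩ A n)) atTop (𝓝 0) := by
      refine hm (fun n => B ∩ A n) (fun n => hC.inter_mem (hP B hB).1 (hA n))
        (fun i j hij => inter_subset_inter_right _ (hanti hij)) ?_
      rw [← inter_iInter, hempty, inter_empty]
    have h2 : ∀ n, m (B \ A n) = m B - m (B ∩ A n) := fun n => by
      rw [← sdiff_inter_self_eq_sdiff, inter_comm,
        m.isAdditiveOn.sdiff (hP B hB).1 (hC.inter_mem (hP B hB).1 (hA n)) inter_subset_left]
    simp only [h2]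
    have h3 := (tendsto_const_nhds (x := m B)).sub h1
    rw [sub_zero] at h3
    exact (continuous_enorm.tendsto _).comp h3
  filter_upwards [hlim.eventually (lt_mem_nhds hlt)] with n hn
  have h1 : ∑ B ∈ P, ‖m (B \ A n)‖ₑ ≤ variation L m (A 0 \ A n) :=
    sum_le_variation m.empty P (f := fun B => B \ A n)
      (fun B hB => ⟨hC.sdiff_mem (hP B hB).1 (hA n), sdiff_subset_sdiff_left (hP B hB).2⟩)
      fun B hB C hC hne => (hd hB hC hne).mono sdiff_subset sdiff_subset
  have h2 := variation_union m.isAdditiveOn (hA n) (hC.sdiff_mem (hA 0) (hA n))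
    disjoint_sdiff_right
  rw [union_sdiff_cancel (hanti (Nat.zero_le n))] at h2
  have h3 : variation L m (A 0) < variation L m (A 0 \ A n) + ε := by
    rcases eq_or_ne ε ⊤ with rfl | hεt
    · rw [add_top]
      exact hne.lt_top
    · exact ENNReal.sub_lt_iff_lt_right hεt (not_le.1 h0).le |>.1 (hn.trans_le h1)
  rw [h2, add_comm] at h3
  exact ((ENNReal.add_lt_add_iff_left (m.variation_ne_top _)).1 h3).le

variable [mY : MeasurableSpace Y]

theorem IsSigmaSmooth.exists_isVariationMeasure (hm : IsSigmaSmooth m)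
    (hY : mY = MeasurableSpace.generateFrom L) :
    ∃ μ : Measure Y, ∀ A ∈ generateSetAlgebra L, μ A = variation L m A := by
  have hR : IsSetRing (generateSetAlgebra L) := isSetAlgebra_generateSetAlgebra.isSetRing
  let a : AddContent ℝ≥0∞ (generateSetAlgebra L) :=
    hR.addContent_of_union (variation L m) (variation_empty m.empty)
      fun hs ht h => variation_union m.isAdditiveOn hs ht h
  have hgen : mY = MeasurableSpace.generateFrom (generateSetAlgebra L) := by
    rw [hY, generateFrom_generateSetAlgebra_eq]
  have hsub : a.IsSigmaSubadditive :=
    isSigmaSubadditive_of_addContent_iUnion_eq_tsum hR fun f hf hUf hd =>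
      addContent_iUnion_eq_sum_of_tendsto_zero hR a (fun s _ => m.variation_ne_top s)
        (fun s hs h1 h2 => hm.tendsto_variation hs h1 h2) hf hUf hd
  exact ⟨a.measure hR.isSetSemiring hgen.le hsub, fun A hA =>
    a.measure_eq hR.isSetSemiring hgen hsub hA⟩

variable {μ : Measure Y} (hY : mY = MeasurableSpace.generateFrom L)
  (hμ : ∀ A ∈ generateSetAlgebra L, μ A = variation L m A)
include hY hμ

omit hY in
theorem isFiniteMeasure_of_eq_variation : IsFiniteMeasure μ :=
  ⟨by
    rw [hμ _ isSetAlgebra_generateSetAlgebra.univ_mem]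
    exact (m.variation_ne_top _).lt_top⟩

/-- `m` extends to a complex measure dominated by `μ`, whose density `g` comes from its real and
imaginary parts. Comparing total masses shows that its variation is `μ`; hence `|g| = 1` almost
everywhere. -/
theorem exists_polar_decomposition : ∃ f : Y → ℂ, Measurable f ∧ (∀ y, ‖f y‖ = 1) ∧
    ∀ A ∈ generateSetAlgebra L, m A = ∫ y in A, f y ∂μ := by
  have hfin : IsFiniteMeasure μ := isFiniteMeasure_of_eq_variation hμ
  have hA : IsSetAlgebra (generateSetAlgebra L) := isSetAlgebra_generateSetAlgebra
  let a : AddContent ℂ (generateSetAlgebra L) :=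
    hA.isSetRing.addContent_of_union m m.empty fun hs ht h => m.additive _ hs _ ht h
  have hgen : mY = MeasurableSpace.generateFrom (generateSetAlgebra L) := by
    rw [hY, generateFrom_generateSetAlgebra_eq]
  have hmeas : ∀ A ∈ generateSetAlgebra L, MeasurableSet A := fun A hA => by
    rw [hgen]
    exact MeasurableSpace.measurableSet_generateFrom hA
  obtain ⟨c, hc, hcμ⟩ : ∃ c : ComplexMeasure Y,
      (∀ A ∈ generateSetAlgebra L, c A = m A) ∧ ∀ A, ‖c A‖ₑ ≤ μ A :=
    VectorMeasure.exists_extension_of_isSetSemiring_of_le_measure_of_generateFrom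
      (m := a) hA.isSetRing.isSetSemiring (fun A hA => by
        rw [hμ A hA]
        exact enorm_le_variation m.empty hA Subset.rfl) hgen
  have hc0 : ∀ A, μ A = 0 → c A = 0 := fun A h0 => by
    have := hcμ A
    rw [h0] at this
    exact enorm_eq_zero.1 (le_antisymm this zero_le)
  have hre : c.re ≪ᵥ μ.toENNRealVectorMeasure := by
    refine VectorMeasure.AbsolutelyContinuous.mk fun A hA h => ?_
    rw [Measure.toENNRealVectorMeasure_apply_measurable hA] at h
    change (c A).re = 0
    rw [hc0 A h, Complex.zero_re]
  have him : c.im ≪ᵥ μ.toENNRealVectorMeasure := by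
    refine VectorMeasure.AbsolutelyContinuous.mk fun A hA h => ?_
    rw [Measure.toENNRealVectorMeasure_apply_measurable hA] at h
    change (c A).im = 0
    rw [hc0 A h, Complex.zero_im]
  let g : Y → ℂ := fun y => ⟨c.re.rnDeriv μ y, c.im.rnDeriv μ y⟩
  have ire := SignedMeasure.integrable_rnDeriv c.re μ
  have iim := SignedMeasure.integrable_rnDeriv c.im μ
  have hgm : Measurable g :=
    Complex.measurableEquivRealProd.symm.measurable.comp
      ((SignedMeasure.measurable_rnDeriv c.re μ).prodMk (SignedMeasure.measurable_rnDeriv c.im μ))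
  have hgi : Integrable g μ := by
    have := (ire.ofReal (𝕜 := ℂ)).add ((iim.ofReal (𝕜 := ℂ)).mul_const Complex.I)
    refine this.congr (Eventually.of_forall fun y => ?_)
    exact (Complex.mk_eq_add_mul_I _ _).symm
  have hcg : μ.withDensityᵥ g = c := by
    ext A hA
    rw [withDensityᵥ_apply hgi hA]
    apply Complex.ext
    · have h1 := congrArg (fun v : SignedMeasure Y => v A)
        (SignedMeasure.withDensityᵥ_rnDeriv_eq c.re μ hre)
      simp only [withDensityᵥ_apply ire hA] at h1
      have h2 := integral_re (𝕜 := ℂ) (hgi.integrableOn (s := A))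
      exact h2.symm.trans h1
    · have h1 := congrArg (fun v : SignedMeasure Y => v A)
        (SignedMeasure.withDensityᵥ_rnDeriv_eq c.im μ him)
      simp only [withDensityᵥ_apply iim hA] at h1
      have h2 := integral_im (𝕜 := ℂ) (hgi.integrableOn (s := A))
      exact h2.symm.trans h1
  have hvar : c.variation = μ := by
    have hle : c.variation ≤ μ := VectorMeasure.variation_le_of_forall_enorm_le fun A _ => hcμ A
    have := isFiniteMeasure_of_le μ hle
    refine Measure.eq_of_le_of_measure_univ_eq hle (le_antisymm (hle _) ?_)
    rw [hμ _ hA.univ_mem]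
    refine variation_le fun P hP hd => ?_
    refine (Finset.sum_congr rfl fun B hB => ?_).le.trans
      (c.le_variation MeasurableSet.univ (fun _ _ => subset_univ _) hd)
    rw [hc B (hP B hB).1]
  have hg1 : ∀ᵐ y ∂μ, ‖g y‖ = 1 := by
    have h1 := Measure.variation_withDensityᵥ hgi
    rw [hcg, hvar] at h1
    have h2 : μ.withDensity (fun y => ‖g y‖ₑ) = μ.withDensity 1 := by
      rw [withDensity_one, ← h1]
    have h3 := (withDensity_eq_iff_of_sigmaFinite hgm.enorm.aemeasurable
      measurable_one.aemeasurable).1 h2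
    filter_upwards [h3] with y hy
    rw [← toReal_enorm, hy]
    simp
  classical
  -- Changing the density on a null set makes its modulus 1 everywhere.
  refine ⟨fun y => if ‖g y‖ = 1 then g y else 1, ?_, fun y => ?_, fun A hA => ?_⟩
  · exact Measurable.ite (measurableSet_eq_fun hgm.norm measurable_const) hgm measurable_const
  · beta_reduce
    split_ifs with h
    · exact h
    · exact norm_one
  · rw [← hc A hA, ← hcg, withDensityᵥ_apply hgi (hmeas A hA)]
    refine setIntegral_congr_ae (hmeas A hA) ?_
    filter_upwards [hg1] with y hy _
    rw [if_pos hy]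

variable {G : Type v} [Group G] [MulAction G Y] [InvariantFamily G L]

omit hμ in
theorem measurable_smul_of_generateFrom (g : G) : Measurable fun y : Y => g • y := by
  have key : Measurable[MeasurableSpace.generateFrom L, MeasurableSpace.generateFrom L]
      fun y : Y => g • y :=
    @measurable_generateFrom _ _ (MeasurableSpace.generateFrom L) _ _ fun F hF =>
      MeasurableSpace.measurableSet_generateFrom (InvariantFamily.preimage_mem g hF)
  rwa [← hY] at key

/-- Quasi-invariance speaks only of the algebra, so a null set of the `σ`-algebra is approximated by
a member `t` of the algebra simultaneously for `μ` and its image, using their sum. -/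
theorem map_smul_absolutelyContinuous (hm : IsQuasiInvariant G m) (g : G) :
    μ.map (fun y => g • y) ≪ μ := by
  have hfin : IsFiniteMeasure μ := isFiniteMeasure_of_eq_variation hμ
  have hG := preimage_smul_mem_generateSetAlgebra (G := G) L
  have hA : IsSetAlgebra (generateSetAlgebra L) := isSetAlgebra_generateSetAlgebra
  have hgm : Measurable fun y : Y => g • y := measurable_smul_of_generateFrom hY g
  have hgen : mY = MeasurableSpace.generateFrom (generateSetAlgebra L) := by
    rw [hY, generateFrom_generateSetAlgebra_eq]
  refine Measure.AbsolutelyContinuous.mk fun s hs h0 => ?_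
  refine le_antisymm (ENNReal.le_of_forall_pos_le_add fun ε hε _ => ?_) zero_le
  have hε2 : (0 : ℝ≥0∞) < (ε / 2 : NNReal) := ENNReal.coe_pos.2 (half_pos hε)
  obtain ⟨δ, hδ, H⟩ := (isQuasiInvariant_iff m hG).1 hm g _ hε2
  obtain ⟨t, ht, hlt⟩ := exists_measure_symmDiff_lt_of_generateFrom_isSetRing
    (μ := μ + μ.map fun y => g • y) hA.isSetRing
    ⟨{univ}, countable_singleton _, singleton_subset_iff.2 hA.univ_mem, by simp⟩ hgen hs
    (lt_min hδ hε2)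
  have hts : MeasurableSet t := by
    rw [hgen]
    exact MeasurableSpace.measurableSet_generateFrom ht
  have h1 : μ t < δ := by
    refine lt_of_le_of_lt ?_ (hlt.trans_le (min_le_left _ _))
    calc μ t ≤ μ (symmDiff t s ∪ s) := measure_mono fun y hy => by
          by_cases hys : y ∈ s
          · exact Or.inr hys
          · exact Or.inl (Or.inl ⟨hy, hys⟩)
      _ ≤ μ (symmDiff t s) + μ s := measure_union_le _ _
      _ = μ (symmDiff t s) := by rw [h0, add_zero]
      _ ≤ _ := Measure.le_add_right le_rfl _
  have h2 : μ.map (fun y => g • y) t < (ε / 2 : NNReal) := by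
    rw [Measure.map_apply hgm hts, hμ _ (hG g t ht)]
    exact H t ht (hμ t ht ▸ h1)
  have h3 : μ.map (fun y => g • y) (symmDiff t s) ≤ (ε / 2 : NNReal) :=
    (Measure.le_add_left le_rfl _).trans (hlt.le.trans (min_le_right _ _))
  calc μ.map (fun y => g • y) s ≤ μ.map (fun y => g • y) (t ∪ symmDiff t s) :=
        measure_mono fun y hy => by
          by_cases hyt : y ∈ t
          · exact Or.inl hyt
          · exact Or.inr (Or.inr ⟨hy, hyt⟩)
    _ ≤ (ε / 2 : NNReal) + (ε / 2 : NNReal) := (measure_union_le _ _).trans (add_le_add h2.le h3)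
    _ = 0 + ε := by
        rw [← ENNReal.coe_add, add_halves, zero_add]

theorem exists_density_translate (hm : IsQuasiInvariant G m) {f : Y → ℂ} (hf : Measurable f)
    (hf1 : ∀ y, ‖f y‖ = 1) (hmf : ∀ A ∈ generateSetAlgebra L, m A = ∫ y in A, f y ∂μ) (g : G) :
    ∃ d : Y → ℂ, Measurable d ∧ Integrable d μ ∧
      ∀ A ∈ generateSetAlgebra L, measureTranslate g m A = ∫ y in A, d y * f y ∂μ := by
  have hfin : IsFiniteMeasure μ := isFiniteMeasure_of_eq_variation hμ
  have hG := preimage_smul_mem_generateSetAlgebra (G := G) L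
  have hgm : ∀ g : G, Measurable fun y : Y => g • y := measurable_smul_of_generateFrom hY
  have hmeas : ∀ A ∈ generateSetAlgebra L, MeasurableSet A := fun A hA => by
    rw [hY, ← generateFrom_generateSetAlgebra_eq]
    exact MeasurableSpace.measurableSet_generateFrom hA
  have hac : μ.map (fun y => g • y) ≪ μ := map_smul_absolutelyContinuous hY hμ hm g
  let ρ : Y → ℝ := fun y => ((μ.map fun y => g • y).rnDeriv μ y).toReal
  have hρm : Measurable ρ := (Measure.measurable_rnDeriv _ _).ennreal_toReal
  have hρi : Integrable ρ μ := Measure.integrable_toReal_rnDeriv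
  have hfg : Measurable fun y => f (g⁻¹ • y) := hf.comp (hgm g⁻¹)
  have hconj : Measurable fun y => starRingEnd ℂ (f y) :=
    Complex.continuous_conj.measurable.comp hf
  have hdm : Measurable fun y => (ρ y : ℂ) * (f (g⁻¹ • y) * starRingEnd ℂ (f y)) :=
    (Complex.measurable_ofReal.comp hρm).mul (hfg.mul hconj)
  -- The translate of `f μ` by `g` has density `ρ(y) f(g⁻¹y)` against `μ`; dividing by `f` is
  -- multiplying by its conjugate, as `|f| = 1`.
  refine ⟨fun y => ρ y * (f (g⁻¹ • y) * starRingEnd ℂ (f y)), hdm, ?_, fun A hA => ?_⟩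
  · refine hρi.mono hdm.aestronglyMeasurable (Eventually.of_forall fun y => ?_)
    simp [hf1]
  · have h1 : ∀ y, (ρ y : ℂ) * (f (g⁻¹ • y) * starRingEnd ℂ (f y)) * f y =
        ρ y • f (g⁻¹ • y) := by
      intro y
      have : starRingEnd ℂ (f y) * f y = 1 := by
        rw [← Complex.normSq_eq_conj_mul_self, Complex.normSq_eq_norm_sq, hf1]
        simp
      rw [mul_assoc, mul_assoc, this, mul_one, Complex.real_smul]
    simp only [h1]
    rw [setIntegral_rnDeriv_smul hac (hmeas A hA),
      setIntegral_map (hmeas A hA) hfg.aestronglyMeasurable (hgm g).aemeasurable]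
    simp only [inv_smul_smul]
    exact hmf _ (hG g A hA)

end SigmaSmooth

theorem IsSigmaSmooth.exists_isQuasiInvarianceFactor {Y : Type u} {L : Set (Set Y)}
    {m : RegularMeasure L} {G : Type v} [Group G] [MulAction G Y] [InvariantFamily G L]
    (hm : IsSigmaSmooth m) (hq : IsQuasiInvariant G m) :
    ∃ d : G → Y → ℂ, IsQuasiInvarianceFactor m d := by
  let _ : MeasurableSpace Y := MeasurableSpace.generateFrom L
  obtain ⟨μ, hμ⟩ := hm.exists_isVariationMeasure rfl
  obtain ⟨f, hf, hf1, hmf⟩ := exists_polar_decomposition rfl hμ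
  choose d hd using exists_density_translate (G := G) rfl hμ hq hf hf1 hmf
  exact ⟨d, μ, f, hμ, hf, hf1, hmf, hd⟩

/-! ### Quasi-invariance factors on the Wallman space -/

section Factors

variable {X : Type u} {L : Set (Set X)}

/-- Two finitely additive set functions on the Wallman extension that are absolutely continuous
with respect to a regular measure agree if they agree on the basic sets. -/
theorem IsWallmanExtension.eq_of_eq_basic {a : Set X → ℝ≥0∞} {μ : Measure (Wallman L)}
    (hμ : IsWallmanExtension L a μ) {φ ψ : Set (Wallman L) → ℂ}
    (hφ : IsAdditiveOn (closedFamily (Wallman L) .all) φ)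
    (hψ : IsAdditiveOn (closedFamily (Wallman L) .all) ψ)
    (acφ : ∀ ε : ℝ≥0∞, 0 < ε → ∃ δ : ℝ≥0∞, 0 < δ ∧
      ∀ A ∈ generateSetAlgebra (closedFamily (Wallman L) .all), μ A < δ → ‖φ A‖ₑ < ε)
    (acψ : ∀ ε : ℝ≥0∞, 0 < ε → ∃ δ : ℝ≥0∞, 0 < δ ∧
      ∀ A ∈ generateSetAlgebra (closedFamily (Wallman L) .all), μ A < δ → ‖ψ A‖ₑ < ε)
    (h : ∀ F ∈ L, φ (Wallman.basic L F) = ψ (Wallman.basic L F)) {A : Set (Wallman L)}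
    (hA : A ∈ generateSetAlgebra (closedFamily (Wallman L) .all)) : φ A = ψ A := by
  have hC := isSetAlgebra_generateSetAlgebra (𝒜 := closedFamily (Wallman L) .all)
  rw [← sub_eq_zero, ← enorm_eq_zero]
  refine le_antisymm (ENNReal.le_of_forall_pos_le_add fun ε hε _ => ?_) zero_le
  have hε4 : (0 : ℝ≥0∞) < (ε / 4 : NNReal) := ENNReal.coe_pos.2 (by positivity)
  obtain ⟨δ₁, hδ₁, H₁⟩ := acφ _ hε4
  obtain ⟨δ₂, hδ₂, H₂⟩ := acψ _ hε4
  obtain ⟨K, hK, hKA, h1⟩ := hμ.inner A (measurableSet_of_mem_generateSetAlgebra hA) _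
    (lt_min hδ₁ hδ₂)
  obtain ⟨F, hF, hKF, h2⟩ := hμ.outer K hK _ (lt_min hδ₁ hδ₂)
  have mK : K ∈ generateSetAlgebra (closedFamily (Wallman L) .all) := .base _ hK
  have mF : Wallman.basic L F ∈ generateSetAlgebra (closedFamily (Wallman L) .all) :=
    .base _ (Wallman.isClosed_basic hF)
  have m1 := hC.sdiff_mem hA mK
  have m2 := hC.sdiff_mem mF mK
  -- Since `φ` and `ψ` agree on the basic set of `F`, their difference at `K` is expressed through
  -- the small set around `K`.
  have e : φ A - ψ A = (φ (A \ K) - ψ (A \ K)) -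
      (φ (Wallman.basic L F \ K) - ψ (Wallman.basic L F \ K)) := by
    rw [hφ.sdiff hA mK hKA, hψ.sdiff hA mK hKA, hφ.sdiff mF mK hKF, hψ.sdiff mF mK hKF, h F hF]
    ring
  rw [e, zero_add]
  calc ‖(φ (A \ K) - ψ (A \ K)) - (φ (Wallman.basic L F \ K) - ψ (Wallman.basic L F \ K))‖ₑ
      ≤ (‖φ (A \ K)‖ₑ + ‖ψ (A \ K)‖ₑ) +
        (‖φ (Wallman.basic L F \ K)‖ₑ + ‖ψ (Wallman.basic L F \ K)‖ₑ) :=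
        enorm_sub_le.trans (add_le_add enorm_sub_le enorm_sub_le)
    _ ≤ ((ε / 4 : NNReal) + (ε / 4 : NNReal)) + ((ε / 4 : NNReal) + (ε / 4 : NNReal)) := by
        gcongr
        · exact (H₁ _ m1 (h1.trans_le (min_le_left _ _))).le
        · exact (H₂ _ m1 (h1.trans_le (min_le_right _ _))).le
        · exact (H₁ _ m2 (h2.trans_le (min_le_left _ _))).le
        · exact (H₂ _ m2 (h2.trans_le (min_le_right _ _))).le
    _ = ε := by
        rw [← ENNReal.coe_add, ← ENNReal.coe_add]
        congr 1
        ring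

/-- The `σ`-algebra on the Wallman extension generated by the basic sets. -/
@[reducible]
def basicMeasurableSpace (L : Set (Set X)) : MeasurableSpace (Wallman L) :=
  MeasurableSpace.generateFrom (Wallman.basic L '' L)

theorem basicMeasurableSpace_le :
    basicMeasurableSpace L ≤ (inferInstance : MeasurableSpace (Wallman L)) :=
  MeasurableSpace.generateFrom_le fun _ ⟨_, hF, hA⟩ =>
    hA ▸ measurableSet_of_isClosed (Wallman.isClosed_basic hF)

/-- Integrals of functions pulled back along two maps that push measures to the same measure. -/
theorem integral_comp_of_measure_preimage_eq {X W Z : Type*} [MeasurableSpace X]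
    [MeasurableSpace W] [mZ : MeasurableSpace Z] {μ : Measure X} {P : Measure W}
    [IsFiniteMeasure μ] {ι : X → Z} {j : W → Z} (hι : Measurable ι)
    (hj : Measurable j) {C : Set (Set Z)} (hC : mZ = MeasurableSpace.generateFrom C)
    (hpi : IsPiSystem C) (huniv : univ ∈ C) (heq : ∀ A ∈ C, μ (ι ⁻¹' A) = P (j ⁻¹' A))
    {h : Z → ℂ} (hh : Measurable h) :
    (Integrable (h ∘ ι) μ → Integrable (h ∘ j) P) ∧
      ∀ A, MeasurableSet A → ∫ x in ι ⁻¹' A, h (ι x) ∂μ = ∫ y in j ⁻¹' A, h (j y) ∂P := by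
  have key : ∀ A ∈ C, μ.map ι A = P.map j A := by
    intro A hA
    have mA : MeasurableSet A := by
      rw [hC]
      exact MeasurableSpace.measurableSet_generateFrom hA
    rw [Measure.map_apply hι mA, Measure.map_apply hj mA, heq A hA]
  have hmap : μ.map ι = P.map j :=
    ext_of_generate_finite C hC hpi key (key univ huniv)
  refine ⟨fun hi => ?_, fun A hA => ?_⟩
  · rw [← integrable_map_measure hh.aestronglyMeasurable hι.aemeasurable, hmap] at hi
    exact (integrable_map_measure hh.aestronglyMeasurable hj.aemeasurable).1 hi
  · rw [← setIntegral_map hA hh.aestronglyMeasurable hι.aemeasurable, hmap,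
      setIntegral_map hA hh.aestronglyMeasurable hj.aemeasurable]

/-- The image of `μ` under `ι` and the restriction of `P` to the `σ`-algebra of basic sets agree on
basic sets, which form a `π`-system. The smaller `σ`-algebra is needed because `ι` need not be
measurable for all Borel sets. -/
theorem IsWallmanExtension.setIntegral_eq [MeasurableSpace X] {m : RegularMeasure L}
    {P : Measure (Wallman L)} (hP : IsWallmanExtension L (variation L m) P)
    (hL : IsSetLattice L) {μ : Measure X} (hμ : ∀ A ∈ generateSetAlgebra L, μ A = variation L m A)
    {ι : X → Wallman L} (hι : Measurable[_, basicMeasurableSpace L] ι)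
    (hιL : ∀ F ∈ L, ι ⁻¹' Wallman.basic L F = F) {h : Wallman L → ℂ}
    (hh : Measurable[basicMeasurableSpace L] h) :
    (Integrable (h ∘ ι) μ → Integrable h P) ∧
      ∀ F ∈ L, ∫ x in F, h (ι x) ∂μ = ∫ Y in Wallman.basic L F, h Y ∂P := by
  have hfin : IsFiniteMeasure μ := isFiniteMeasure_of_eq_variation hμ
  have key := @integral_comp_of_measure_preimage_eq X (Wallman L) (Wallman L) _ _
    (basicMeasurableSpace L) μ P _ ι id hι (measurable_id'' basicMeasurableSpace_le)
    (Wallman.basic L '' L) rfl (by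
      rintro _ ⟨E, hE, rfl⟩ _ ⟨F, hF, rfl⟩ -
      exact ⟨E ∩ F, hL.inter_mem hE hF, Wallman.basic_inter hE hF⟩)
    ⟨univ, hL.univ_mem, Wallman.basic_univ⟩ (by
      rintro _ ⟨F, hF, rfl⟩
      rw [hιL F hF, preimage_id, hP.basic F hF, hμ F (.base _ hF)]) h hh
  refine ⟨key.1, fun F hF => ?_⟩
  have := key.2 _ (MeasurableSpace.measurableSet_generateFrom ⟨F, hF, rfl⟩)
  rwa [hιL F hF] at this

theorem isAdditiveOn_setIntegral {P : Measure (Wallman L)} {h : Wallman L → ℂ}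
    (hh : Integrable h P) :
    IsAdditiveOn (closedFamily (Wallman L) .all) fun A => ∫ Y in A, h Y ∂P :=
  fun _ _ _ hB hAB => setIntegral_union hAB (measurableSet_of_mem_generateSetAlgebra hB)
    hh.integrableOn hh.integrableOn

theorem exists_enorm_setIntegral_lt {P : Measure (Wallman L)} {h : Wallman L → ℂ}
    (hh : Integrable h P) (ε : ℝ≥0∞) (hε : 0 < ε) :
    ∃ δ : ℝ≥0∞, 0 < δ ∧ ∀ A ∈ generateSetAlgebra (closedFamily (Wallman L) .all), P A < δ →
      ‖∫ Y in A, h Y ∂P‖ₑ < ε := by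
  obtain ⟨δ, hδ, H⟩ := exists_pos_setLIntegral_lt_of_measure_lt hh.2.ne hε.ne'
  exact ⟨δ, hδ, fun A _ hA => (enorm_integral_le_lintegral_enorm _).trans_lt (H A hA)⟩

theorem IsExtension.exists_isQuasiInvarianceFactor (hL : IsSetLattice L) {m : RegularMeasure L}
    {p : RegularMeasure (closedFamily (Wallman L) .all)} {P : Measure (Wallman L)}
    (h : IsExtension m p P) {G : Type v} [Group G] [MulAction G X] [InvariantFamily G L]
    (hm : IsQuasiInvariant G m) {ι : X → Wallman L} (hιL : ∀ F ∈ L, ι ⁻¹' Wallman.basic L F = F)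
    {d : G → X → ℂ} (hd : IsQuasiInvarianceFactor m d) :
    ∃ d' : G → Wallman L → ℂ, IsQuasiInvarianceFactor p d' ∧ ∀ g x, d' g (ι x) = d g x := by
  let mX : MeasurableSpace X := MeasurableSpace.generateFrom L
  obtain ⟨μ, f, hμ, hf, hf1, hmf, hdg⟩ := hd
  have hfinP := h.wallman.finite
  -- Hence every measurable function on `X` factors through `ι` as a measurable function on the
  -- Wallman space.
  have hcomap : mX = (basicMeasurableSpace L).comap ι := by
    rw [basicMeasurableSpace, MeasurableSpace.comap_generateFrom, image_image,
      image_congr hιL, image_id']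
  have hι : Measurable[mX, basicMeasurableSpace L] ι := by
    rw [hcomap]
    exact comap_measurable ι
  have factor : ∀ {e : X → ℂ}, Measurable[mX] e →
      ∃ e' : Wallman L → ℂ, Measurable[basicMeasurableSpace L] e' ∧ e = e' ∘ ι := by
    intro e he
    rw [hcomap] at he
    exact @Measurable.exists_eq_measurable_comp _ _ _ (basicMeasurableSpace L) _ _ _ _ _ he
  obtain ⟨f₀, hf₀, hff₀⟩ := factor hf
  choose d' hd' hdd' using fun g => factor (hdg g).1
  classical
  -- The factored polar density may have the wrong modulus off the image of `X`; `r` corrects it and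
  -- leaves unimodular values alone.
  let r : ℂ → ℂ := fun z => if ‖z‖ = 1 then z else 1
  have hr : Measurable r :=
    Measurable.ite (measurableSet_eq_fun measurable_norm measurable_const) measurable_id
      measurable_const
  let f' : Wallman L → ℂ := r ∘ f₀
  have hf' : Measurable[basicMeasurableSpace L] f' := hr.comp hf₀
  have hf'1 : ∀ Y, ‖f' Y‖ = 1 := by
    intro Y
    simp only [f', r, Function.comp_apply]
    split_ifs with h
    · exact h
    · exact norm_one
  have hf'ι : ∀ x, f' (ι x) = f x := by
    intro x
    have : f₀ (ι x) = f x := (congrFun hff₀ x).symm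
    simp only [f', r, Function.comp_apply, this, hf1, if_true]
  have hd'ι : ∀ g x, d' g (ι x) = d g x := fun g x => (congrFun (hdd' g) x).symm
  have hinv : InvariantFamily G (closedFamily (Wallman L) .all) := Wallman.invariantFamily_closed
  have hGW := preimage_smul_mem_generateSetAlgebra (G := G) (closedFamily (Wallman L) .all)
  have hq := (isQuasiInvariant_iff p hGW).1 (h.isQuasiInvariant hm)
  have acp : ∀ (g : G) (ε : ℝ≥0∞), 0 < ε → ∃ δ : ℝ≥0∞, 0 < δ ∧
      ∀ A ∈ generateSetAlgebra (closedFamily (Wallman L) .all), P A < δ →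
        ‖measureTranslate g p A‖ₑ < ε := by
    intro g ε hε
    obtain ⟨δ, hδ, H⟩ := hq g ε hε
    refine ⟨δ, hδ, fun A hA hlt => ?_⟩
    rw [← h.variation_eq A hA] at hlt
    exact (enorm_le_variation p.empty (hGW g A hA) Subset.rfl).trans_lt (H A hA hlt)
  have addp : ∀ g : G, IsAdditiveOn (closedFamily (Wallman L) .all) (measureTranslate g p) :=
    fun g A hA B hB hAB => p.additive _ (hGW g A hA) _ (hGW g B hB) (hAB.preimage _)
  have tp : ∀ (g : G), ∀ F ∈ L, measureTranslate g p (Wallman.basic L F) =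
      measureTranslate g m F := fun g F hF => by
    rw [measureTranslate, Wallman.preimage_smul_basic g hF,
      h.basic _ (InvariantFamily.preimage_mem g hF), measureTranslate]
  have if' : Integrable f' P := by
    refine Integrable.of_bound (hf'.mono basicMeasurableSpace_le le_rfl).aestronglyMeasurable 1 ?_
    exact Eventually.of_forall fun Y => (hf'1 Y).le
  have hfinμ : IsFiniteMeasure μ := isFiniteMeasure_of_eq_variation hμ
  have id' : ∀ g, Integrable (d' g) P := fun g =>
    (h.wallman.setIntegral_eq hL hμ hι hιL (hd' g)).1 (hdd' g ▸ (hdg g).2.1)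
  have idf' : ∀ g, Integrable (fun Y => d' g Y * f' Y) P := fun g =>
    (id' g).mul_bdd (c := 1) if'.aestronglyMeasurable
      (Eventually.of_forall fun Y => (hf'1 Y).le)
  refine ⟨d', ⟨P, f', fun A hA => (h.variation_eq A hA).symm,
    hf'.mono basicMeasurableSpace_le le_rfl, hf'1, fun A hA => ?_, fun g =>
    ⟨(hd' g).mono basicMeasurableSpace_le le_rfl, id' g, fun A hA => ?_⟩⟩, hd'ι⟩
  -- Absolute continuity of `p` itself is the case `g = 1` of `acp`.
  · have h1 : measureTranslate (1 : G) p = p := by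
      funext B
      simp [measureTranslate]
    refine h.wallman.eq_of_eq_basic p.isAdditiveOn (isAdditiveOn_setIntegral if')
      (h1 ▸ acp 1) (exists_enorm_setIntegral_lt if') (fun F hF => ?_) hA
    rw [h.basic F hF, hmf F (.base _ hF), ← (h.wallman.setIntegral_eq hL hμ hι hιL hf').2 F hF]
    simp only [hf'ι]
  · refine h.wallman.eq_of_eq_basic (addp g) (isAdditiveOn_setIntegral (idf' g))
      (acp g) (exists_enorm_setIntegral_lt (idf' g)) (fun F hF => ?_) hA
    have := (h.wallman.setIntegral_eq hL hμ hι hιL ((hd' g).mul hf')).2 F hF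
    simp only [Pi.mul_apply, hf'ι, hd'ι] at this
    rw [tp g F hF, (hdg g).2.2 F (.base _ hF), this]

end Factors

end QuasiInv

/-! ### Assembling the map `v` -/

theorem theorem11 {X : Type*} [TopologicalSpace X] [T35Space X]
    {G : Type*} [Group G] [MulAction G X] [ContinuousConstSMul G X]
    (k : QuasiInv.ClosedKind) :
    ∃ v : QuasiInv.QuasiInvariantMeasure G (QuasiInv.closedFamily X k) →
        QuasiInv.QuasiInvariantMeasure G
          (QuasiInv.closedFamily (QuasiInv.Wallman (QuasiInv.closedFamily X k)) .all),
      ∀ m : QuasiInv.QuasiInvariantMeasure G (QuasiInv.closedFamily X k),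
        (∀ F' : Set (QuasiInv.Wallman (QuasiInv.closedFamily X k)), IsClosed F' →
          (∃ S : QuasiInv.FilterIn (QuasiInv.closedFamily X k),
            ⋂ F ∈ S.sets, closure (QuasiInv.toWallman k '' F) = F') ∧
          ∀ S : QuasiInv.FilterIn (QuasiInv.closedFamily X k),
            ⋂ F ∈ S.sets, closure (QuasiInv.toWallman k '' F) = F' →
              S.Limit m.1 ((v m).1 F')) ∧
        (∀ F ∈ QuasiInv.closedFamily X k,
          (v m).1 (closure (QuasiInv.toWallman k '' F)) = m.1 F) ∧
        (QuasiInv.IsRealMeasure m.1 ↔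
          ∀ F' : Set (QuasiInv.Wallman (QuasiInv.closedFamily X k)), IsClosed F' →
            F' ⊆ (range (QuasiInv.toWallman (X := X) k))ᶜ → (v m).1 F' = 0) ∧
        (QuasiInv.IsSigmaSmooth m.1 → QuasiInv.IsSigmaSmooth (v m).1 →
          QuasiInv.variation (QuasiInv.closedFamily X k) m.1 univ < ⊤ →
          (∃ d : G → X → ℂ, QuasiInv.IsQuasiInvarianceFactor m.1 d) ∧
          ∀ d : G → X → ℂ, QuasiInv.IsQuasiInvarianceFactor m.1 d →
            ∃ d' : G → QuasiInv.Wallman (QuasiInv.closedFamily X k) → ℂ,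
              QuasiInv.IsQuasiInvarianceFactor (v m).1 d' ∧
              ∀ (μ : @MeasureTheory.Measure X
                  (MeasurableSpace.generateFrom (QuasiInv.closedFamily X k))),
                QuasiInv.IsVariationMeasure m.1 μ →
                ∀ g : G, ∀ᵐ x ∂μ, d' g (QuasiInv.toWallman k x) = d g x) := by
  have hL := QuasiInv.isSetLattice_closedFamily (X := X) k
  choose p μ h using fun m : QuasiInv.QuasiInvariantMeasure G (QuasiInv.closedFamily X k) =>
    QuasiInv.exists_isExtension hL (QuasiInv.isDisjunctive_closedFamily k) m.1
  refine ⟨fun m => ⟨p m, (h m).isQuasiInvariant m.2⟩, fun m => ⟨fun F' hF' => ⟨?_, ?_⟩, ?_, ?_, ?_⟩⟩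
  · refine ⟨QuasiInv.Wallman.hullFilter hL F', ?_⟩
    rw [QuasiInv.iInter_closure_toWallman, QuasiInv.Wallman.iInter_hullFilter hL hF']
  · intro S hS
    rw [QuasiInv.iInter_closure_toWallman] at hS
    exact (h m).limit hL S hF' hS
  · intro F hF
    rw [QuasiInv.closure_image_toWallman k hF]
    exact (h m).basic F hF
  · exact (h m).isRealMeasure_iff
  · intro hσ _ _
    refine ⟨hσ.exists_isQuasiInvarianceFactor m.2, fun d hd => ?_⟩
    obtain ⟨d', hd', hdd⟩ := (h m).exists_isQuasiInvarianceFactor hL m.2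
      (fun F hF => QuasiInv.preimage_toWallman_basic k hF) hd
    -- The factorisation gives equality at every point of `X`.
    exact ⟨d', hd', fun μ _ g => Filter.Eventually.of_forall fun x => hdd g x⟩
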